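/- Let $n\ge 1$ and let $\mathbb R_n$ be the real Clifford algebra generated by $\mathbf e_1,\dots,\mathbf e_n$ with $\mathbf e_r\mathbf e_s+\mathbf e_s\mathbf e_r=-2\delta_{rs}$, with the norm $|a|=\big(\sum_A a_A^2\big)^{1/2}$ for $a=\sum_A a_A\mathbf e_A$, where $\mathbf e_A=\mathbf e_{i_1}\cdots\mathbf e_{i_s}$ for $A=\{i_1<\dots<i_s\}\subseteq\{1,\dots,n\}$ and $\mathbf e_\varnothing=1$. Identify $\mathbb R^{n+1}$ with the set of paravectors $x_0+x_1\mathbf e_1+\dots+x_n\mathbf e_n$ (with the Euclidean norm), and let $\mathbb S=\{x_1\mathbf e_1+\dots+x_n\mathbf e_n: x_1^2+\dots+x_n^2=1\}$, so that $I^2=-1$ for $I\in\mathbb S$. A function $f:\mathbb R^{n+1}\to\mathbb R_n$ is left slice monogenic if it is real differentiable and, for every $I\in\mathbb S$ and all $u,v\in\mathbb R$, $\frac12\big(\frac{\partial}{\partial u}+I\frac{\partial}{\partial v}\big)f(u+Iv)=0$. For $I\in\mathbb S$ and $g\in L^1(\mathbb R;\mathbb R_n)$ put $$\mathscr F_I(g)(w)=\frac1{\sqrt{2\pi}}\int_{\mathbb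 R}e^{-Iuw}g(u)\,du ,$$ and for $g\in L^2(\mathbb R;\mathbb R_n)$ let $\mathscr F_I(g)\in L^2(\mathbb R;\mathbb R_n)$ be the $L^2$-limit of $\mathscr F_I(g\mathbf 1_{[-T,T]})$ as $T\to\infty$. The support of a function defined up to null sets is the complement of the largest open set on which it vanishes almost everywhere. **Theorem.** Let $f:\mathbb R^{n+1}\to\mathbb R_n$ be left slice monogenic with $f|_{\mathbb R}\in L^2(\mathbb R)$, and let $B>0$. The following two conditions are equivalent: (i) there is a constant $C$ such that $|f(u+Iv)|\le Ce^{B|u+Iv|}$ for all $I\in\mathbb S$ and $u,v\in\mathbb R$; (ii) $\operatorname{supp}\mathscr F_I(f|_{\mathbb R})\subset[-B,B]$ for all $I\in\mathbb S$. Moreover, if one of these conditions holds, then for all $I\in\mathbb S$ and $u,v\in\mathbb R$, $$f(u+Iv)=\frac1{\sqrt{2\pi}}\int_{-B}^{B}e^{I(u+Iv)w}\,\mathscr F_I(f|_{\mathbb R})(w)\,dw .$$ -/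

import Mathlib

open MeasureTheory Filter Topology

noncomputable section

/-- The quadratic form `v ↦ -|v|²` on `ℝⁿ`. -/
def negSq (n : ℕ) : QuadraticForm ℝ (EuclideanSpace ℝ (Fin n)) :=
  -LinearMap.BilinMap.toQuadraticMap (innerₗ (EuclideanSpace ℝ (Fin n)))

theorem negSq_apply (n : ℕ) (v : EuclideanSpace ℝ (Fin n)) : negSq n v = -‖v‖ ^ 2 := by
  simp [negSq]

/-- The real Clifford algebra `ℝ_n`. -/
abbrev Cl (n : ℕ) : Type := CliffordAlgebra (negSq n)

namespace Cl

/-- The inclusion of `ℝⁿ` as the space `ℝ_n^1` of vectors. -/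
abbrev vec {n : ℕ} (v : EuclideanSpace ℝ (Fin n)) : Cl n := CliffordAlgebra.ι (negSq n) v

/-- The imaginary unit `e_i`. -/
def e {n : ℕ} (i : Fin n) : Cl n := vec (EuclideanSpace.single i 1)

theorem e_mul_e_add {n : ℕ} (r s : Fin n) :
    (e r * e s + e s * e r : Cl n) = algebraMap ℝ (Cl n) (-2 * if r = s then 1 else 0) := by
  unfold e vec
  rw [CliffordAlgebra.ι_mul_ι_add_swap]
  congr 1
  simp only [QuadraticMap.polar, negSq_apply, @norm_add_sq_real]
  simp only [EuclideanSpace.inner_single_left, PiLp.norm_single]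
  simp [eq_comm]
  split_ifs <;> simp

/-- `e_A = e_{i_1} ⋯ e_{i_s}` for `A = {i_1 < ⋯ < i_s}`. -/
def blade {n : ℕ} (A : Finset (Fin n)) : Cl n :=
  (List.ofFn fun j : Fin A.card => (e (A.orderEmbOfFin rfl j) : Cl n)).prod

theorem changeForm_proof (n : ℕ) :
    LinearMap.BilinMap.toQuadraticMap (innerₗ (EuclideanSpace ℝ (Fin n))) =
      (0 : QuadraticForm ℝ (EuclideanSpace ℝ (Fin n))) - negSq n := by
  simp [negSq]

theorem contractLeft_prod {n : ℕ} (i : Fin n) (l : List (Fin n)) (h : i ∉ l) :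
    CliffordAlgebra.contractLeft (innerₗ (EuclideanSpace ℝ (Fin n)) (EuclideanSpace.single i 1))
      ((l.map fun j => ExteriorAlgebra.ι ℝ (EuclideanSpace.single j (1 : ℝ))).prod) = 0 := by
  induction l with
  | nil => exact CliffordAlgebra.contractLeft_one _ _
  | cons a l ih =>
    simp only [List.mem_cons, not_or] at h
    rw [List.map_cons, List.prod_cons]
    refine (CliffordAlgebra.contractLeft_ι_mul _ _ _).trans ?_
    rw [ih h.2]
    simp [EuclideanSpace.inner_single_left, h.1]

theorem changeForm_prod {n : ℕ} (l : List (Fin n)) (h : l.Nodup) :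
    CliffordAlgebra.changeForm (changeForm_proof n) ((l.map fun j => (e j : Cl n)).prod) =
      (l.map fun j => ExteriorAlgebra.ι ℝ (EuclideanSpace.single j (1 : ℝ))).prod := by
  induction l with
  | nil => exact CliffordAlgebra.changeForm_one _
  | cons a l ih =>
    simp only [List.nodup_cons] at h
    rw [List.map_cons, List.prod_cons, List.map_cons, List.prod_cons]
    refine (CliffordAlgebra.changeForm_ι_mul _ _ _).trans ?_
    rw [ih h.2, contractLeft_prod a l h.1, sub_zero]

/-- The `e_A` form a basis of `ℝ_n`. -/
def basis (n : ℕ) : Module.Basis (Finset (Fin n)) ℝ (Cl n) :=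
  (EuclideanSpace.basisFun (Fin n) ℝ).toBasis.ExteriorAlgebra.map
    (CliffordAlgebra.changeFormEquiv (changeForm_proof n)).symm

theorem basis_apply {n : ℕ} (A : Finset (Fin n)) : basis n A = blade A := by
  rw [basis, Module.Basis.map_apply, LinearEquiv.symm_apply_eq,
    CliffordAlgebra.changeFormEquiv_apply, ExteriorAlgebra.basis_apply]
  have h : (blade A : Cl n) =
      ((List.ofFn fun j : Fin A.card => A.orderEmbOfFin rfl j).map fun j => (e j : Cl n)).prod := by
    rw [List.map_ofFn]; rfl
  rw [h, changeForm_prod _ (List.nodup_ofFn.2 (A.orderEmbOfFin rfl).injective), List.map_ofFn]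
  simp only [ExteriorAlgebra.ιMulti_apply]
  congr 2
  funext j
  simp
  rfl

/-- The norm `|a| = (∑_A a_A²)^(1/2)` of a Clifford number `a = ∑_A a_A e_A`. -/
instance instNormedAddCommGroup (n : ℕ) : NormedAddCommGroup (Cl n) :=
  NormedAddCommGroup.induced (Cl n) (EuclideanSpace ℝ (Finset (Fin n)))
    ((WithLp.linearEquiv 2 ℝ (Finset (Fin n) → ℝ)).symm.toLinearMap ∘ₗ
      (basis n).equivFun.toLinearMap)
    ((WithLp.linearEquiv 2 ℝ (Finset (Fin n) → ℝ)).symm.injective.comp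
      (basis n).equivFun.injective)

theorem norm_eq {n : ℕ} (a : Cl n) : ‖a‖ = √(∑ A, (basis n).repr a A ^ 2) := by
  have : ‖a‖ = ‖WithLp.toLp 2 ((basis n).equivFun a)‖ := rfl
  simp [this, EuclideanSpace.norm_eq]

instance instNormedSpace (n : ℕ) : NormedSpace ℝ (Cl n) where
  norm_smul_le r a := by
    rw [norm_eq, norm_eq, Real.norm_eq_abs, ← Real.sqrt_sq_eq_abs, ← Real.sqrt_mul (sq_nonneg r),
      Finset.mul_sum]
    simp [mul_pow]

instance instFiniteDimensional (n : ℕ) : FiniteDimensional ℝ (Cl n) :=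
  (basis n).finiteDimensional_of_finite

instance instCompleteSpace (n : ℕ) : CompleteSpace (Cl n) := FiniteDimensional.complete ℝ (Cl n)

instance instIsTopologicalRing (n : ℕ) : IsTopologicalRing (Cl n) where
  continuous_mul := by
    have h : Continuous fun p : Cl n × Cl n =>
        LinearMap.toContinuousLinearMap
          ((LinearMap.toContinuousLinearMap :
            (Cl n →ₗ[ℝ] Cl n) ≃ₗ[ℝ] (Cl n →L[ℝ] Cl n)).toLinearMap ∘ₗ LinearMap.mul ℝ (Cl n)) p.1 p.2 := by
      fun_prop
    exact h

end Cl

namespace Cl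

theorem vec_mul_self {n : ℕ} {I : EuclideanSpace ℝ (Fin n)} (hI : ‖I‖ = 1) :
    (vec I * vec I : Cl n) = -1 := by
  rw [vec, CliffordAlgebra.ι_sq_scalar, negSq_apply, hI]
  simp

/-- For `f ∈ L¹(ℝ; ℝ_n)` and a unit vector `I`, the one-dimensional left-sided Clifford Fourier
transform `w ↦ (2π)^(-1/2) ∫ e^{-Iuw} f(u) du`. -/
def fourierL1 {n : ℕ} (I : EuclideanSpace ℝ (Fin n)) (f : ℝ → Cl n) (w : ℝ) : Cl n :=
  (√(2 * Real.pi))⁻¹ • ∫ u : ℝ, NormedSpace.exp (-(u * w) • vec I) * f u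

/-- `g ∈ L²(ℝ; ℝ_n)` is the limit in `L²`, as `T → ∞`, of the transforms of the truncations
of `f` to `[-T, T]`. -/
def IsFourierL2 {n : ℕ} (I : EuclideanSpace ℝ (Fin n)) (f g : ℝ → Cl n) : Prop :=
  MemLp g 2 volume ∧
    Tendsto (fun T : ℝ => eLpNorm (fun w => g w - fourierL1 I ((Set.Icc (-T) T).indicator f) w) 2
      volume) atTop (𝓝 0)

section existence

open scoped FourierTransform SchwartzMap ENNReal

variable {E : Type*} [NormedAddCommGroup E] [InnerProductSpace ℂ E] [CompleteSpace E]

theorem fourier_toLp_ae {h : ℝ → E} (h1 : Integrable h) (h2 : MemLp h 2 volume) :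
    ((𝓕 (h2.toLp h) : Lp E 2 (volume : Measure ℝ)) : ℝ → E) =ᵐ[volume] 𝓕 h := by
  have hc : Continuous (𝓕 h) :=
    VectorFourier.fourierIntegral_continuous Real.continuous_fourierChar
      (by fun_prop) h1
  refine ae_eq_of_integral_contDiff_smul_eq
    ((Lp.memLp _).locallyIntegrable (by norm_num)) hc.locallyIntegrable fun g gs gc => ?_
  have hg₁ : HasCompactSupport (Complex.ofRealCLM ∘ g) := gc.comp_left rfl
  have hg₂ : ContDiff ℝ (⊤ : ℕ∞) (Complex.ofRealCLM ∘ g) := by fun_prop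
  set φ : 𝓢(ℝ, ℂ) := hg₁.toSchwartzMap hg₂ with hφ
  have e1 := congrArg (fun S => S φ) (Lp.fourier_toTemperedDistribution_eq (h2.toLp h))
  simp only [TemperedDistribution.fourier_apply, Lp.toTemperedDistribution_apply] at e1
  have e2 : ∫ x, (𝓕 φ) x • (h2.toLp h) x = ∫ x, (𝓕 φ) x • h x := by
    apply integral_congr_ae
    filter_upwards [h2.coeFn_toLp] with x hx
    rw [hx]
  have e3 := VectorFourier.integral_fourierIntegral_smul_eq_flip (L := innerₗ ℝ) (μ := volume)
    (ν := volume) Real.continuous_fourierChar (by fun_prop) φ.integrable h1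
  have e4 : ∫ x, (𝓕 φ) x • h x = ∫ x, φ x • 𝓕 h x := by
    simpa using! e3
  exact e1.symm.trans (e2.trans e4)

theorem tendsto_truncate {F : Type*} [NormedAddCommGroup F] {h : ℝ → F} (h2 : MemLp h 2 volume) :
    Tendsto (fun T : ℝ => eLpNorm (fun u => h u - (Set.Icc (-T) T).indicator h u) 2 volume)
      atTop (𝓝 0) := by
  simp only [eLpNorm_eq_lintegral_rpow_enorm_toReal (p := 2) (by norm_num) (by norm_num)]
  have hfin := lintegral_rpow_enorm_lt_top_of_eLpNorm_lt_top (p := 2) (by norm_num) (by norm_num)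
    h2.eLpNorm_lt_top
  have key : Tendsto (fun T : ℝ => ∫⁻ u, ‖h u - (Set.Icc (-T) T).indicator h u‖ₑ ^ (2 : ℝ≥0∞).toReal)
      atTop (𝓝 (∫⁻ _ : ℝ, 0)) := by
    refine tendsto_lintegral_filter_of_dominated_convergence'
      (fun u => ‖h u‖ₑ ^ (2 : ℝ≥0∞).toReal) (Eventually.of_forall fun T => ?_)
      (Eventually.of_forall fun T => ae_of_all _ fun u => ?_) hfin.ne (ae_of_all _ fun u => ?_)
    · exact (h2.1.sub (h2.1.indicator measurableSet_Icc)).enorm.pow_const _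
    · by_cases hu : u ∈ Set.Icc (-T) T <;> simp [hu]
    · refine tendsto_const_nhds.congr' ?_
      filter_upwards [eventually_ge_atTop |u|] with T hT
      have hu : u ∈ Set.Icc (-T) T := ⟨(abs_le.1 hT).1, (abs_le.1 hT).2⟩
      simp [hu]
  rw [lintegral_zero] at key
  have := (ENNReal.continuous_rpow_const (y := 1 / (2 : ℝ≥0∞).toReal)).tendsto 0 |>.comp key
  simpa [Function.comp_def] using this

theorem eLpNorm_comp_div {F : Type*} [NormedAddCommGroup F] (G : ℝ → F)
    (hG : AEStronglyMeasurable G volume) :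
    AEStronglyMeasurable (fun w => G (w / (2 * Real.pi))) volume ∧
    eLpNorm (fun w => G (w / (2 * Real.pi))) 2 volume =
      ENNReal.ofReal (2 * Real.pi) ^ (1 / (2 : ℝ≥0∞).toReal) * eLpNorm G 2 volume := by
  have hpi : (2 * Real.pi)⁻¹ ≠ 0 := by positivity
  have hm : MeasurableEmbedding fun w : ℝ => w * (2 * Real.pi)⁻¹ :=
    (Homeomorph.mulRight₀ _ hpi).measurableEmbedding
  have hmap := Real.map_volume_mul_right hpi
  rw [inv_inv, abs_of_pos (by positivity)] at hmap
  simp only [div_eq_mul_inv]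
  constructor
  · refine AEStronglyMeasurable.comp_measurable (f := fun w : ℝ => w * (2 * Real.pi)⁻¹) (g := G) ?_
      hm.measurable
    rw [hmap]
    exact hG.mono_ac Measure.smul_absolutelyContinuous
  · have := hm.eLpNorm_map_measure (g := G) (p := 2) (μ := volume)
    rw [hmap, eLpNorm_smul_measure_of_ne_top (by norm_num)] at this
    simpa [Function.comp_def] using this.symm

theorem exists_fourierL2_complex {h : ℝ → E} (h2 : MemLp h 2 volume) :
    ∃ H : ℝ → E, MemLp H 2 volume ∧
      Tendsto (fun T : ℝ => eLpNorm (fun w => H w - (√(2 * Real.pi))⁻¹ •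
        ∫ u : ℝ, Complex.exp ((-(u * w) : ℝ) * Complex.I) • (Set.Icc (-T) T).indicator h u) 2 volume)
        atTop (𝓝 0) := by
  set c : ℝ := (√(2 * Real.pi))⁻¹
  set G : Lp E 2 (volume : Measure ℝ) := 𝓕 (h2.toLp h) with hG
  obtain ⟨a1, a2⟩ := eLpNorm_comp_div _ (Lp.aestronglyMeasurable G)
  refine ⟨fun w => c • G (w / (2 * Real.pi)), MemLp.const_smul ⟨a1, ?_⟩ c, ?_⟩
  · rw [a2]
    exact ENNReal.mul_lt_top (ENNReal.rpow_lt_top_of_nonneg (by simp) ENNReal.ofReal_ne_top) (Lp.eLpNorm_lt_top G)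
  have hT2 : ∀ T : ℝ, MemLp ((Set.Icc (-T) T).indicator h) 2 volume := fun T =>
    h2.indicator measurableSet_Icc
  have hT1 : ∀ T : ℝ, Integrable ((Set.Icc (-T) T).indicator h) := fun T =>
    (integrable_indicator_iff measurableSet_Icc).2
      ((h2.locallyIntegrable (by norm_num)).integrableOn_isCompact isCompact_Icc)
  have key : ∀ T : ℝ, eLpNorm (fun w => c • G (w / (2 * Real.pi)) - c •
        ∫ u : ℝ, Complex.exp ((-(u * w) : ℝ) * Complex.I) • (Set.Icc (-T) T).indicator h u) 2 volume =
      ‖c‖ₑ * (ENNReal.ofReal (2 * Real.pi) ^ (1 / (2 : ℝ≥0∞).toReal) *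
        eLpNorm (fun u => h u - (Set.Icc (-T) T).indicator h u) 2 volume) := by
    intro T
    have b1 : (fun w => c • G (w / (2 * Real.pi)) - c •
        ∫ u : ℝ, Complex.exp ((-(u * w) : ℝ) * Complex.I) • (Set.Icc (-T) T).indicator h u) =
        c • fun w => (G - 𝓕 ((Set.Icc (-T) T).indicator h) : ℝ → E) (w / (2 * Real.pi)) := by
      funext w
      simp only [Pi.smul_apply, Pi.sub_apply, smul_sub]
      congr 2
      rw [Real.fourier_eq']
      congr 1
      funext u
      congr 2
      push_cast
      simp
      field_simp
    have hae := fourier_toLp_ae (hT1 T) (hT2 T)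
    have b2 : (G - 𝓕 ((Set.Icc (-T) T).indicator h) : ℝ → E) =ᵐ[volume]
        (𝓕 (h2.toLp h - (hT2 T).toLp _) : Lp E 2 (volume : Measure ℝ)) := by
      have : (𝓕 (h2.toLp h - (hT2 T).toLp _) : Lp E 2 (volume : Measure ℝ)) =
          G - 𝓕 ((hT2 T).toLp _) := (Lp.fourierTransformₗᵢ ℝ E).map_sub _ _
      rw [this]
      filter_upwards [hae, Lp.coeFn_sub G (𝓕 ((hT2 T).toLp _))] with x hx hy
      rw [hy, Pi.sub_apply, Pi.sub_apply, hx]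
    rw [b1, eLpNorm_const_smul]
    rw [(eLpNorm_comp_div _ ((Lp.aestronglyMeasurable _).congr b2.symm)).2, eLpNorm_congr_ae b2,
      ← Lp.enorm_def, ← ofReal_norm (𝓕 _ : Lp E 2 (volume : Measure ℝ)), Lp.norm_fourier_eq,
      ofReal_norm, ← MemLp.toLp_sub, Lp.enorm_toLp]
    rfl
  simp only [key]
  have h0 := tendsto_truncate h2
  have h3 := ENNReal.Tendsto.const_mul (a := ENNReal.ofReal (2 * Real.pi) ^ (1 / (2 : ℝ≥0∞).toReal))
    h0 (Or.inr (ENNReal.rpow_lt_top_of_nonneg (by simp) ENNReal.ofReal_ne_top).ne)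
  have h4 := ENNReal.Tendsto.const_mul (a := ‖c‖ₑ) h3 (Or.inr (by simp))
  simpa using h4

end existence

/-- The embedding of `ℂ` onto `ℝ + Iℝ`. -/
def ofComplex {n : ℕ} (I : EuclideanSpace ℝ (Fin n)) (hI : ‖I‖ = 1) : ℂ →ₐ[ℝ] Cl n :=
  Complex.liftAux (vec I) (vec_mul_self hI)

theorem exp_smul_vec {n : ℕ} {I : EuclideanSpace ℝ (Fin n)} (hI : ‖I‖ = 1) (t : ℝ) :
    NormedSpace.exp (t • vec I : Cl n) = ofComplex I hI (Complex.exp (t * Complex.I)) := by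
  have h := NormedSpace.exp_series_hasSum_exp' (𝕂 := ℝ) (t * Complex.I : ℂ)
  have hm := h.mapL (ofComplex I hI).toLinearMap.toContinuousLinearMap
  rw [← Complex.exp_eq_exp_ℂ] at hm
  have ht : ofComplex I hI (t * Complex.I) = t • vec I := by
    simp [ofComplex, Complex.liftAux_apply]
  rw [NormedSpace.exp_eq_tsum ℝ]
  refine HasSum.tsum_eq ?_
  have he : (fun k : ℕ => ((Nat.factorial k : ℝ)⁻¹ • (t • vec I) ^ k : Cl n)) = fun k : ℕ =>
      ofComplex I hI ((Nat.factorial k : ℝ)⁻¹ • (t * Complex.I : ℂ) ^ k) := by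
    funext k
    rw [map_smul, map_pow, ht]
  rw [he]
  exact hm

theorem exists_isFourierL2 {n : ℕ} {I : EuclideanSpace ℝ (Fin n)} (hI : ‖I‖ = 1) {f : ℝ → Cl n}
    (hf : MemLp f 2 volume) : ∃ g, IsFourierL2 I f g := by
  let C : Cl n →L[ℝ] EuclideanSpace ℂ (Finset (Fin n)) := LinearMap.toContinuousLinearMap
    ((WithLp.linearEquiv 2 ℝ (Finset (Fin n) → ℂ)).symm.toLinearMap ∘ₗ
      LinearMap.pi fun A => Complex.ofRealCLM.toLinearMap ∘ₗ (basis n).coord A)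
  let Φ : EuclideanSpace ℂ (Finset (Fin n)) →L[ℝ] Cl n := LinearMap.toContinuousLinearMap
    (∑ A, LinearMap.mulRight ℝ (basis n A) ∘ₗ (ofComplex I hI).toLinearMap ∘ₗ
      (LinearMap.proj A : (Finset (Fin n) → ℂ) →ₗ[ℝ] ℂ) ∘ₗ
      (WithLp.linearEquiv 2 ℝ (Finset (Fin n) → ℂ)).toLinearMap)
  have hΦ : ∀ z a, Φ (z • C a) = ofComplex I hI z * a := by
    intro z a
    conv_rhs => rw [← (basis n).sum_repr a]
    simp only [Finset.mul_sum, mul_smul_comm]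
    simp [Φ, C, Algebra.smul_def, mul_assoc, Algebra.commutes]
  obtain ⟨H, hH, hlim⟩ := exists_fourierL2_complex (C.comp_memLp' hf)
  refine ⟨fun w => Φ (H w), Φ.comp_memLp' hH, ?_⟩
  have hb : ∀ T : ℝ, eLpNorm (fun w => Φ (H w) - fourierL1 I ((Set.Icc (-T) T).indicator f) w) 2
      volume ≤ ‖Φ‖₊ • eLpNorm (fun w => H w - (√(2 * Real.pi))⁻¹ •
        ∫ u : ℝ, Complex.exp ((-(u * w) : ℝ) * Complex.I) •
          (Set.Icc (-T) T).indicator (C ∘ f) u) 2 volume := by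
    intro T
    refine eLpNorm_le_nnreal_smul_eLpNorm_of_ae_le_mul (ae_of_all _ fun w => ?_) _
    have e1 : fourierL1 I ((Set.Icc (-T) T).indicator f) w = Φ ((√(2 * Real.pi))⁻¹ •
        ∫ u : ℝ, Complex.exp ((-(u * w) : ℝ) * Complex.I) •
          (Set.Icc (-T) T).indicator (C ∘ f) u) := by
      rw [map_smul, ← ContinuousLinearMap.integral_comp_comm]
      · unfold fourierL1
        congr 2
        funext u
        rw [exp_smul_vec hI, ← hΦ]
        by_cases hu : u ∈ Set.Icc (-T) T <;> simp [hu]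
      · have hi : Integrable ((Set.Icc (-T) T).indicator (C ∘ f)) :=
          (integrable_indicator_iff measurableSet_Icc).2
            (((C.comp_memLp' hf).locallyIntegrable (by norm_num)).integrableOn_isCompact
              isCompact_Icc)
        refine hi.norm.mono' ?_ ?_
        · have hc : Continuous fun u : ℝ => Complex.exp ((-(u * w) : ℝ) * Complex.I) := by fun_prop
          exact hc.aestronglyMeasurable.smul hi.1
        · exact ae_of_all _ fun u => by
            rw [norm_smul, Complex.norm_exp_ofReal_mul_I, one_mul]
    rw [e1, ← map_sub]
    exact Φ.le_opNorm _
  refine tendsto_of_tendsto_of_tendsto_of_le_of_le tendsto_const_nhds ?_ (fun _ => zero_le) hb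
  have := ENNReal.Tendsto.const_mul (a := (‖Φ‖₊ : ENNReal)) hlim (Or.inr (by simp))
  simpa [ENNReal.smul_def] using this

end Cl

/-- The points of `ℝ^{n+1} = ℝ ⊕ ℝ^n`, with the Euclidean norm. -/
abbrev Paravector (n : ℕ) : Type := WithLp 2 (ℝ × EuclideanSpace ℝ (Fin n))

namespace Paravector

/-- A point of `ℝ^{n+1}` as a paravector `x_0 + x_1 e_1 + ⋯ + x_n e_n` in `ℝ_n`. -/
def toCl {n : ℕ} (x : Paravector n) : Cl n := algebraMap ℝ (Cl n) x.fst + Cl.vec x.snd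

/-- The unit sphere `𝕊` of vectors. -/
abbrev S (n : ℕ) : Set (EuclideanSpace ℝ (Fin n)) := Metric.sphere 0 1

/-- The point `u + I v`. -/
def mk {n : ℕ} (u : ℝ) (I : EuclideanSpace ℝ (Fin n)) (v : ℝ) : Paravector n :=
  WithLp.toLp 2 (u, v • I)

theorem toCl_mk {n : ℕ} (u : ℝ) (I : EuclideanSpace ℝ (Fin n)) (v : ℝ) :
    (mk u I v).toCl = algebraMap ℝ (Cl n) u + Cl.vec I * algebraMap ℝ (Cl n) v := by
  simp [toCl, mk, Algebra.algebraMap_eq_smul_one]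

/-- The point `u` of the real axis. -/
def ofReal {n : ℕ} (u : ℝ) : Paravector n := WithLp.toLp 2 (u, 0)

end Paravector

open Paravector

/-- `f` is left slice monogenic on `U`: it is real differentiable and
`½ (∂/∂u + I ∂/∂v) f(u + Iv) = 0` on `U ∩ L_I` for every `I ∈ 𝕊`. -/
structure IsLeftSliceMonogenicOn {n : ℕ} (f : Paravector n → Cl n) (U : Set (Paravector n)) :
    Prop where
  isOpen : IsOpen U
  differentiableOn : DifferentiableOn ℝ f U
  cauchyRiemann : ∀ I ∈ S n, ∀ u v : ℝ, mk u I v ∈ U →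
    (1 / 2 : ℝ) • (deriv (fun s : ℝ => f (mk s I v)) u +
      Cl.vec I * deriv (fun t : ℝ => f (mk u I t)) v) = 0

open Classical in
/-- The transform `𝓕_I f` of `f ∈ L²(ℝ; ℝ_n)`, `I ∈ 𝕊`: the `L²` limit of the transforms
of the truncations of `f` (a representative of it). -/
def fourierL2 {n : ℕ} (I : EuclideanSpace ℝ (Fin n)) (f : ℝ → Cl n) : ℝ → Cl n :=
  if h : ∃ g, Cl.IsFourierL2 I f g then h.choose else 0

theorem fourierL2_spec {n : ℕ} {I : EuclideanSpace ℝ (Fin n)} (hI : I ∈ S n) {f : ℝ → Cl n}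
    (hf : MemLp f 2 volume) : Cl.IsFourierL2 I f (fourierL2 I f) := by
  have h := Cl.exists_isFourierL2 (by simpa using hI) hf
  rw [fourierL2, dif_pos h]
  exact h.choose_spec

/-- The support of a measurable function on `ℝ` defined up to null sets: the complement of the
largest open set on which it vanishes almost everywhere. -/
def essSupport {n : ℕ} (g : ℝ → Cl n) : Set ℝ :=
  (⋃₀ {V : Set ℝ | IsOpen V ∧ ∀ᵐ w ∂volume.restrict V, g w = 0})ᶜ

end

/-! ### Phragmén–Lindelöf bounds for functions of exponential type -/

section PaleyWienerComplex

variable {E : Type*} [NormedAddCommGroup E] [NormedSpace ℂ E]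

/-! Everything reduces to the classical Paley–Wiener theorem for entire functions with values in a
complex Hilbert space. For `I` in the sphere, the real-linear map a ↦ a - iIa into the
complexification of the Clifford algebra (`Cl.splitting`) turns left multiplication by `I` into
multiplication by i, and taking real coordinates (`Cl.rePart`) recovers a. Under it the restriction
of f to the slice ℝ + Iℝ becomes an entire function
(`IsLeftSliceMonogenicOn.differentiable_sliceFun`), and the transform along `I` becomes the ordinary
L² Fourier transform, rescaled by 2π (`splitting_fourierL2_ae`).

Growth implies support (`fourier_eq_zero_of_exp_type`). An L² function need not come with a
pointwise bound on ℝ, but its primitive grows at most linearly there. Phragmén–Lindelöf for the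
primitive and a Cauchy estimate give |f(z)| ≤ M(2+|z|)e^{B|Im z|}. Multiplying by (1 - iεz)⁻³
produces quadratic decay in a half-plane, so Cauchy's theorem kills the Fourier integral beyond B on
one side. By Plancherel this survives the L² limit ε → 0; the sign of ε selects the side.

Support implies formula and growth (`eq_integral_of_fourier_eq_zero`, `norm_le_of_fourier_eq_zero`).
A transform in L² with bounded support is integrable, so Fourier inversion gives the integral
formula on ℝ; both sides are entire, hence agree on ℂ. Estimating the integral gives the growth
bound, with a constant controlled by ∫|f|² through Plancherel. Since the norm of `Cl.splitting I` is
bounded uniformly in `I`, one constant serves all slices. -/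

open Complex in
theorem one_add_norm_le_two_mul_norm_add_I {z : ℂ} (hz : 0 ≤ z.im) : 1 + ‖z‖ ≤ 2 * ‖z + I‖ := by
  have h1 : ‖z + I‖ ^ 2 = ‖z‖ ^ 2 + 2 * z.im + 1 := by
    rw [← normSq_eq_norm_sq, ← normSq_eq_norm_sq, normSq_apply, normSq_apply]
    simp
    ring
  nlinarith [norm_nonneg z, norm_nonneg (z + I), sq_nonneg (‖z‖ - 1)]

open Complex in
/-- A Phragmén–Lindelöf bound in the upper half-plane for functions of exponential type with
linear growth on the real axis. -/
theorem norm_le_of_exp_type_of_real_upper {P : ℂ → E} (hP : Differentiable ℂ P) {B C : ℝ}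
    (hB : 0 ≤ B) (hC : ∀ z, ‖P z‖ ≤ C * (1 + ‖z‖) * Real.exp (B * ‖z‖))
    (hR : ∀ x : ℝ, ‖P x‖ ≤ C * (1 + |x|)) {z : ℂ} (hz : 0 ≤ z.im) :
    ‖P z‖ ≤ 2 * C * (1 + ‖z‖) * Real.exp (B * z.im) := by
  have hC0 : 0 ≤ C := by simpa using (norm_nonneg _).trans (hR 0)
  -- The factor e^{iBz} cancels the growth e^{By} on the imaginary axis, and 1/(z+i), holomorphic on
  -- the closed upper half-plane, absorbs the linear factor.
  set h : ℂ → E := fun z => (exp (I * B * z) / (z + I)) • P z with hh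
  have hne : ∀ z : ℂ, 0 ≤ z.im → z + I ≠ 0 := fun z hz h0 => by
    have := congrArg im h0
    simp at this
    linarith
  have hnorm : ∀ z, ‖h z‖ = Real.exp (-(B * z.im)) / ‖z + I‖ * ‖P z‖ := fun z => by
    simp [hh, norm_smul, Complex.norm_exp]
  have hpos : ∀ z : ℂ, 0 ≤ z.im → 0 < ‖z + I‖ := fun z hz => norm_pos_iff.2 (hne z hz)
  have hd : DifferentiableOn ℂ h {z | 0 ≤ z.im} := by
    intro z hz
    refine DifferentiableAt.differentiableWithinAt ?_
    exact ((by fun_prop : DifferentiableAt ℂ (fun z => exp (I * B * z)) z).div (by fun_prop)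
      (hne z hz)).smul (hP z)
  have hbd : ∀ z : ℂ, 0 ≤ z.im → ‖h z‖ ≤ 2 * C * Real.exp (B * ‖z‖ ^ (1 : ℝ)) := fun z hz => by
    rw [hnorm, div_mul_eq_mul_div, div_le_iff₀ (hpos z hz), Real.rpow_one]
    have h1 := one_add_norm_le_two_mul_norm_add_I hz
    have h2 : Real.exp (-(B * z.im)) ≤ 1 := Real.exp_le_one_iff.2 (by nlinarith)
    calc Real.exp (-(B * z.im)) * ‖P z‖ ≤ 1 * (C * (1 + ‖z‖) * Real.exp (B * ‖z‖)) := by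
          gcongr
          exact hC z
      _ ≤ 1 * (C * (2 * ‖z + I‖) * Real.exp (B * ‖z‖)) := by gcongr
      _ = _ := by ring
  have hre : ∀ x : ℝ, ‖h x‖ ≤ 2 * C := fun x => by
    rw [hnorm, div_mul_eq_mul_div, div_le_iff₀ (hpos x (by simp))]
    have h1 := one_add_norm_le_two_mul_norm_add_I (z := x) (by simp)
    have h2 := hR x
    simp only [ofReal_im, mul_zero, neg_zero, Real.exp_zero, one_mul]
    rw [norm_real, Real.norm_eq_abs] at h1
    nlinarith
  have him : ∀ y : ℝ, 0 ≤ y → ‖h (y * I)‖ ≤ 2 * C := fun y hy => by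
    have hI : (0 : ℝ) ≤ (y * I : ℂ).im := by simpa using hy
    rw [hnorm, div_mul_eq_mul_div, div_le_iff₀ (hpos _ hI)]
    have h1 := one_add_norm_le_two_mul_norm_add_I hI
    have h2 := hC (y * I)
    have h3 : ‖(y * I : ℂ)‖ = y := by simp [abs_of_nonneg hy]
    have h4 : (y * I : ℂ).im = y := by simp
    rw [h3] at h1 h2
    rw [h4]
    calc Real.exp (-(B * y)) * ‖P (y * I)‖ ≤
        Real.exp (-(B * y)) * (C * (1 + y) * Real.exp (B * y)) := by gcongr
      _ = C * (1 + y) := by rw [mul_comm, mul_assoc, ← Real.exp_add]; simp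
      _ ≤ C * (2 * ‖(y * I : ℂ) + I‖) := by gcongr
      _ = _ := by ring
  have hdc : ∀ s : Set ℝ, DiffContOnCl ℂ h (s ×ℂ Set.Ioi 0) := fun s => by
    refine DifferentiableOn.diffContOnCl (hd.mono ?_)
    refine closure_minimal (fun z hz => ?_) (isClosed_le continuous_const continuous_im)
    exact (le_of_lt (show (0 : ℝ) < z.im from hz.2))
  have hO : ∀ s : Set ℝ, ∃ c < (2 : ℝ), ∃ B', h =O[Bornology.cobounded ℂ ⊓ 𝓟 (s ×ℂ Set.Ioi 0)]
      fun z => Real.exp (B' * ‖z‖ ^ c) := fun s => by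
    refine ⟨1, by norm_num, B, Asymptotics.IsBigO.of_bound (2 * C) ?_⟩
    filter_upwards [mem_inf_of_right (mem_principal_self _)] with z hz
    rw [Real.norm_of_nonneg (Real.exp_pos _).le]
    exact hbd z (le_of_lt (show (0 : ℝ) < z.im from hz.2))
  -- Order 1 is critical for a half-plane but admissible for a quadrant (order below 2), so the
  -- half-plane is cut along the imaginary axis, where `h` is also bounded.
  have key : ‖h z‖ ≤ 2 * C := by
    rcases le_total 0 z.re with h0 | h0
    · exact PhragmenLindelof.quadrant_I (hdc _) (hO _) (fun x _ => hre x) him h0 hz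
    · exact PhragmenLindelof.quadrant_II (hdc _) (hO _) (fun x _ => hre x) him h0 hz
  rw [hnorm, div_mul_eq_mul_div, div_le_iff₀ (hpos z hz), Real.exp_neg, inv_mul_le_iff₀
    (Real.exp_pos _)] at key
  have h5 : ‖z + I‖ ≤ 1 + ‖z‖ := by
    have := norm_add_le z I
    rw [norm_I] at this
    linarith
  calc ‖P z‖ ≤ Real.exp (B * z.im) * (2 * C * ‖z + I‖) := key
    _ ≤ Real.exp (B * z.im) * (2 * C * (1 + ‖z‖)) := by gcongr
    _ = _ := by ring

theorem norm_le_of_exp_type_of_real {P : ℂ → E} (hP : Differentiable ℂ P) {B C : ℝ}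
    (hB : 0 ≤ B) (hC : ∀ z, ‖P z‖ ≤ C * (1 + ‖z‖) * Real.exp (B * ‖z‖))
    (hR : ∀ x : ℝ, ‖P x‖ ≤ C * (1 + |x|)) (z : ℂ) :
    ‖P z‖ ≤ 2 * C * (1 + ‖z‖) * Real.exp (B * |z.im|) := by
  rcases le_total 0 z.im with h0 | h0
  · rw [abs_of_nonneg h0]
    exact norm_le_of_exp_type_of_real_upper hP hB hC hR h0
  · have := norm_le_of_exp_type_of_real_upper (P := fun z => P (-z)) (B := B) (C := C) (z := -z)
      (by fun_prop) hB (fun z => by simpa using hC (-z)) (fun x => by simpa using hR (-x))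
      (by simpa using h0)
    rw [abs_of_nonpos h0]
    simpa using this

/-- A function of exponential type `B` that is square integrable on the real axis grows at most
linearly on horizontal lines. -/
theorem exists_norm_le_of_exp_type_of_memLp [CompleteSpace E] {f : ℂ → E}
    (hf : Differentiable ℂ f) {B C : ℝ} (hB : 0 ≤ B) (hC : ∀ z, ‖f z‖ ≤ C * Real.exp (B * ‖z‖))
    (h2 : MemLp (fun x : ℝ => f x) 2 volume) :
    ∃ M, ∀ z, ‖f z‖ ≤ M * (2 + ‖z‖) * Real.exp (B * |z.im|) := by
  -- Phragmén–Lindelöf needs a pointwise bound on the real axis; square integrability supplies one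
  -- for the primitive `P`, not directly for `f`.
  obtain ⟨P, hP0, hP⟩ := hf.isExactOn_univ.with_val_at 0 0
  replace hP : ∀ z, HasDerivAt P (f z) z := fun z => hP z (Set.mem_univ z)
  have hPd : Differentiable ℂ P := fun z => (hP z).differentiableAt
  have hC0 : 0 ≤ C := by simpa using (norm_nonneg _).trans (hC 0)
  set N : ℝ := ∫ x : ℝ, ‖f x‖ ^ 2
  have hN : 0 ≤ N := integral_nonneg fun x => by positivity
  have hint : Integrable fun x : ℝ => ‖f x‖ ^ 2 := h2.integrable_norm_pow (by norm_num)
  have hcf : Continuous fun x : ℝ => f x := hf.continuous.comp Complex.continuous_ofReal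
  have h1 : ∀ z, ‖P z‖ ≤ (C + 1 + N) * (1 + ‖z‖) * Real.exp (B * ‖z‖) := fun z => by
    have := Convex.norm_image_sub_le_of_norm_hasDerivWithin_le (f := P) (f' := f)
      (s := Metric.closedBall (0 : ℂ) ‖z‖) (x := 0) (y := z) (C := C * Real.exp (B * ‖z‖))
      (fun w _ => (hP w).hasDerivWithinAt) (fun w hw => (hC w).trans (by
        have : ‖w‖ ≤ ‖z‖ := by simpa using hw
        gcongr)) (convex_closedBall _ _) (by simp) (by simp)
    rw [hP0, sub_zero, sub_zero] at this
    refine this.trans ?_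
    have e1 : C * Real.exp (B * ‖z‖) * ‖z‖ = C * ‖z‖ * Real.exp (B * ‖z‖) := by ring
    rw [e1]
    have : C * ‖z‖ ≤ (C + 1 + N) * (1 + ‖z‖) := by
      have := norm_nonneg z
      gcongr <;> linarith
    gcongr
  have h3 : ∀ x : ℝ, ‖P x‖ ≤ (C + 1 + N) * (1 + |x|) := fun x => by
    have e1 : ∫ t in (0 : ℝ)..x, f t = P x - P (0 : ℝ) :=
      intervalIntegral.integral_eq_sub_of_hasDerivAt (f := fun t : ℝ => P t)
        (fun t _ => by simpa using! (hP t).scomp t Complex.ofRealCLM.hasDerivAt)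
        (hcf.intervalIntegrable _ _)
    rw [Complex.ofReal_zero, hP0, sub_zero] at e1
    rw [← e1]
    have e2 : ‖∫ t in (0 : ℝ)..x, f t‖ ≤ ∫ t in Set.uIoc 0 x, ‖f t‖ :=
      intervalIntegral.norm_integral_le_integral_norm_uIoc
    have hcn : Continuous fun t : ℝ => ‖f t‖ := hcf.norm
    have hfin : volume (Set.uIoc (0 : ℝ) x) < ⊤ := by simp [Set.uIoc]
    -- From t ≤ 1 + t²: the 1 integrates to |x| and the square to at most `N`.
    have e3 : ∫ t in Set.uIoc 0 x, ‖f t‖ ≤ ∫ t in Set.uIoc 0 x, (1 + ‖f t‖ ^ 2) := by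
      refine setIntegral_mono (intervalIntegrable_iff.1 (hcn.intervalIntegrable _ _))
        (intervalIntegrable_iff.1
          ((by fun_prop : Continuous fun t : ℝ => 1 + ‖f t‖ ^ 2).intervalIntegrable _ _))
        fun t => ?_
      nlinarith [sq_nonneg (‖f t‖ - 1), sq_nonneg ‖f t‖]
    have e4 : ∫ t in Set.uIoc 0 x, (1 + ‖f t‖ ^ 2) = |x| + ∫ t in Set.uIoc 0 x, ‖f t‖ ^ 2 := by
      rw [integral_add (integrableOn_const (C := (1 : ℝ)) hfin.ne (by simp)) hint.integrableOn]
      simp [Set.uIoc, Measure.real, max_sub_min_eq_abs]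
    have e5 : ∫ t in Set.uIoc 0 x, ‖f t‖ ^ 2 ≤ N :=
      setIntegral_le_integral hint (ae_of_all _ fun t => by positivity)
    nlinarith [abs_nonneg x, mul_nonneg hC0 (abs_nonneg x), mul_nonneg hN (abs_nonneg x)]
  have h4 := norm_le_of_exp_type_of_real hPd hB h1 h3
  -- Cauchy's estimate for P' = f on unit circles: there |w| ≤ 1 + |z| and |Im w| ≤ 1 + |Im z|,
  -- which produces 2 + |z| and the factor e^B.
  refine ⟨2 * (C + 1 + N) * Real.exp B, fun z => ?_⟩
  rw [← (hP z).deriv]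
  have h5 := Complex.norm_deriv_le_of_forall_mem_sphere_norm_le (c := z) (R := 1) one_pos
    (C := 2 * (C + 1 + N) * Real.exp B * (2 + ‖z‖) * Real.exp (B * |z.im|))
    hPd.diffContOnCl fun w hw => by
      refine (h4 w).trans ?_
      have hw1 : ‖w - z‖ = 1 := by simpa [dist_eq_norm] using hw
      have hw2 : ‖w‖ ≤ 1 + ‖z‖ := by
        have := norm_add_le (w - z) z
        simp only [sub_add_cancel] at this
        linarith
      have hw3 : |w.im| ≤ 1 + |z.im| := by
        have := abs_add_le (w - z).im z.im
        have h' := Complex.abs_im_le_norm (w - z)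
        simp only [Complex.sub_im, sub_add_cancel] at this h'
        linarith
      calc 2 * (C + 1 + N) * (1 + ‖w‖) * Real.exp (B * |w.im|) ≤
          2 * (C + 1 + N) * (1 + (1 + ‖z‖)) * Real.exp (B * (1 + |z.im|)) := by gcongr
        _ = _ := by rw [mul_add B, Real.exp_add, mul_one]; ring
  simpa using h5

end PaleyWienerComplex

/-! ### Vanishing Fourier integrals by contour shift -/

section PaleyWienerContour

variable {E : Type*} [NormedAddCommGroup E] [NormedSpace ℂ E]

open Complex in
/-- Cauchy's theorem in the upper half-plane for functions of quadratic decay. -/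
theorem integral_real_eq_zero_of_decay_upper {k : ℂ → E}
    (hk : DifferentiableOn ℂ k {z | 0 ≤ z.im}) {D : ℝ}
    (hD : ∀ z : ℂ, 0 ≤ z.im → ‖k z‖ ≤ D / (1 + ‖z‖ ^ 2))
    (hi : Integrable fun x : ℝ => k x) : ∫ x : ℝ, k x = 0 := by
  have hD0 : 0 ≤ D := by simpa using (norm_nonneg _).trans (hD 0 (by simp))
  have hT : Tendsto (fun T : ℝ => ∫ x in (-T)..T, k x) atTop (𝓝 (∫ x : ℝ, k x)) :=
    intervalIntegral_tendsto_integral hi tendsto_neg_atTop_atBot tendsto_id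
  -- Rectangle with corners -T and T + iT: the other three sides have total length 4T and the
  -- integrand there is at most D/T².
  refine tendsto_nhds_unique hT (squeeze_zero_norm' (a := fun T : ℝ => 4 * D * T⁻¹) ?_ ?_)
  swap
  · simpa using tendsto_inv_atTop_zero.const_mul (4 * D)
  filter_upwards [eventually_gt_atTop 0] with T hT0
  have hrect := integral_boundary_rect_eq_zero_of_differentiableOn k (-T : ℂ) (T + T * I)
    (hk.mono fun z hz => by
      have := hz.2
      simp [Set.uIcc_of_le hT0.le] at this
      exact this.1)
  simp only [neg_re, ofReal_re, add_re, mul_re, I_re, mul_zero, ofReal_im, I_im, mul_one,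
    sub_self, add_zero, neg_im, neg_zero, add_im, mul_im, zero_add, ofReal_zero, zero_mul,
    ofReal_neg] at hrect
  have hb : ∀ z : ℂ, 0 ≤ z.im → T ≤ ‖z‖ → ‖k z‖ ≤ D * T⁻¹ * T⁻¹ := fun z hz hTz => by
    refine (hD z hz).trans ?_
    rw [div_eq_mul_inv, mul_assoc, ← mul_inv]
    gcongr
    nlinarith
  have i1 : ‖∫ x in (-T)..T, k (x + T * I)‖ ≤ D * T⁻¹ * T⁻¹ * |T - -T| :=
    intervalIntegral.norm_integral_le_of_norm_le_const fun x _ => by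
      refine hb _ (by simpa using hT0.le) ?_
      have := abs_im_le_norm (x + T * I)
      simp only [add_im, ofReal_im, mul_im, ofReal_re, I_im, mul_one, I_re, mul_zero, add_zero,
        zero_add] at this
      exact (le_abs_self T).trans this
  have i2 : ∀ s : ℝ, |s| = T → ‖∫ y in (0 : ℝ)..T, k (s + y * I)‖ ≤ D * T⁻¹ * T⁻¹ * |T - 0| :=
    fun s hs => intervalIntegral.norm_integral_le_of_norm_le_const fun y hy => by
      rw [Set.uIoc_of_le hT0.le] at hy
      refine hb _ (by simpa using hy.1.le) ?_
      have := abs_re_le_norm (s + y * I)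
      simpa [hs] using this
  have i3 := i2 T (abs_of_pos hT0)
  have i4 := i2 (-T) (by rw [abs_neg, abs_of_pos hT0])
  rw [ofReal_neg] at i4
  have e : ∫ x in (-T)..T, k x = (∫ x in (-T)..T, k (x + T * I)) -
      I • (∫ y in (0 : ℝ)..T, k (T + y * I)) + I • (∫ y in (0 : ℝ)..T, k (-T + y * I)) := by
    rw [← sub_eq_zero, ← hrect]
    abel
  rw [e]
  have i5 := norm_add_le ((∫ x in (-T)..T, k (x + T * I)) -
    I • (∫ y in (0 : ℝ)..T, k (T + y * I))) (I • (∫ y in (0 : ℝ)..T, k (-T + y * I)))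
  have i6 := norm_sub_le (∫ x in (-T)..T, k (x + T * I)) (I • (∫ y in (0 : ℝ)..T, k (T + y * I)))
  rw [norm_smul, norm_I, one_mul] at i5 i6
  refine (i5.trans (by linarith)).trans (le_of_eq (?_ :
    D * T⁻¹ * T⁻¹ * |T - -T| + D * T⁻¹ * T⁻¹ * |T - 0| + D * T⁻¹ * T⁻¹ * |T - 0| = _))
  rw [sub_neg_eq_add, sub_zero, abs_of_pos hT0, abs_of_pos (by linarith)]
  field_simp
  ring

open Complex in
theorem norm_one_sub_mul_I_sq {ε : ℝ} {z : ℂ} :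
    ‖1 - ε * I * z‖ ^ 2 = 1 + 2 * ε * z.im + ε ^ 2 * ‖z‖ ^ 2 := by
  rw [← normSq_eq_norm_sq, ← normSq_eq_norm_sq, normSq_apply, normSq_apply]
  simp
  ring

-- The only zero of 1 - iεz is -i/ε, where ε Im z = -1; the sign hypothesis keeps z in the
-- half-plane away from it.
open Complex in
theorem norm_le_one_sub_mul_I {ε : ℝ} {z : ℂ} (hε : 0 ≤ ε * z.im) :
    1 ≤ ‖1 - ε * I * z‖ ∧ |ε| * ‖z‖ ≤ ‖1 - ε * I * z‖ := by
  have h := norm_one_sub_mul_I_sq (ε := ε) (z := z)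
  constructor
  · refine (pow_le_pow_iff_left₀ (by positivity) (norm_nonneg _) two_ne_zero).1 ?_
    nlinarith [mul_nonneg (sq_nonneg ε) (sq_nonneg ‖z‖)]
  · refine (pow_le_pow_iff_left₀ (by positivity) (norm_nonneg _) two_ne_zero).1 ?_
    rw [h, mul_pow, sq_abs]
    nlinarith

-- In the upper half-plane |e^{-iwz}| = e^{w Im z} absorbs e^{B Im z} because w ≤ -B. Of the three
-- powers of the regularizer, one pays for the linear growth of `f` and two leave the quadratic
-- decay Cauchy's theorem needs.
open Complex in
theorem integral_regularized_eq_zero {f : ℂ → E} (hf : Differentiable ℂ f) {B M : ℝ}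
    (hM : ∀ z, ‖f z‖ ≤ M * (2 + ‖z‖) * Real.exp (B * |z.im|)) {ε : ℝ} (hε : 0 < ε)
    {w : ℝ} (hw : w ≤ -B) :
    ∫ x : ℝ, (exp (-(I * w * x)) * ((1 - ε * I * x) ^ 3)⁻¹) • f x = 0 := by
  have hM0 : 0 ≤ M := by simpa using (norm_nonneg _).trans (hM 0)
  set k : ℂ → E := fun z => (exp (-(I * w * z)) * ((1 - ε * I * z) ^ 3)⁻¹) • f z with hk
  have hn : ∀ z : ℂ, 0 ≤ z.im → 1 ≤ ‖1 - ε * I * z‖ ∧ |ε| * ‖z‖ ≤ ‖1 - ε * I * z‖ := fun z hz =>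
    norm_le_one_sub_mul_I (mul_nonneg hε.le hz)
  have hd : DifferentiableOn ℂ k {z | 0 ≤ z.im} := fun z hz => by
    refine DifferentiableAt.differentiableWithinAt ?_
    have hne : (1 - ε * I * z) ^ 3 ≠ 0 :=
      pow_ne_zero _ (norm_pos_iff.1 (one_pos.trans_le (hn z hz).1))
    exact ((by fun_prop : DifferentiableAt ℂ (fun z => exp (-(I * w * z))) z).mul
      (DifferentiableAt.inv (by fun_prop) hne)).smul (hf z)
  have hb : ∀ z : ℂ, 0 ≤ z.im → ‖k z‖ ≤ (M * (2 + ε⁻¹) * (1 + ε⁻¹ ^ 2)) / (1 + ‖z‖ ^ 2) :=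
      fun z hz => by
    obtain ⟨h1, h2⟩ := hn z hz
    rw [abs_of_pos hε] at h2
    set q := ‖1 - ε * I * z‖ with hq
    have h3 : ‖z‖ ≤ ε⁻¹ * q := by
      rw [inv_mul_eq_div, le_div_iff₀ hε]
      linarith
    have e1 : ‖k z‖ = Real.exp (w * z.im) * (q ^ 3)⁻¹ * ‖f z‖ := by
      simp [hk, norm_smul, Complex.norm_exp, hq]
    have e2 : Real.exp (w * z.im) * Real.exp (B * |z.im|) ≤ 1 := by
      rw [abs_of_nonneg hz, ← Real.exp_add, Real.exp_le_one_iff]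
      nlinarith
    have hq0 : 0 < q := by linarith
    have hei : 0 < ε⁻¹ := by positivity
    rw [e1, le_div_iff₀ (by positivity)]
    calc Real.exp (w * z.im) * (q ^ 3)⁻¹ * ‖f z‖ * (1 + ‖z‖ ^ 2)
        ≤ Real.exp (w * z.im) * (q ^ 3)⁻¹ * (M * (2 + ‖z‖) * Real.exp (B * |z.im|)) *
          (1 + ‖z‖ ^ 2) := by gcongr; exact hM z
      _ = (Real.exp (w * z.im) * Real.exp (B * |z.im|)) *
          (M * (2 + ‖z‖) * (1 + ‖z‖ ^ 2) * (q ^ 3)⁻¹) := by ring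
      -- From 1 ≤ q and |z| ≤ q/ε, each growth factor is bounded by a power of q; together they give
      -- q³.
      _ ≤ 1 * (M * (2 * q + ε⁻¹ * q) * (q ^ 2 + (ε⁻¹ * q) ^ 2) * (q ^ 3)⁻¹) := by
        gcongr
        · linarith
        · nlinarith
      _ = _ := by field_simp
  have hc : Continuous fun x : ℝ => k x := by
    have := hd.continuousOn.comp_continuous continuous_ofReal (fun x => by simp)
    exact this
  refine integral_real_eq_zero_of_decay_upper hd hb ?_
  refine (integrable_inv_one_add_sq.const_mul (M * (2 + ε⁻¹) * (1 + ε⁻¹ ^ 2))).mono'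
    hc.aestronglyMeasurable (ae_of_all _ fun x => ?_)
  have := hb x (by simp)
  simpa [div_eq_mul_inv] using this

end PaleyWienerContour

/-! ### The regularizing multiplier (1 - iεx)⁻³ -/

section Regularization

open scoped FourierTransform ENNReal

variable {E : Type*} [NormedAddCommGroup E] [NormedSpace ℂ E]

/-- Dominated convergence for the squared norms, with majorant ‖2h‖². -/
theorem tendsto_eLpNorm_sub_smul {ι : Type*} {l : Filter ι} [l.IsCountablyGenerated]
    {h : ℝ → E} (h2 : MemLp h 2 volume) {m : ι → ℝ → ℂ} (hm : ∀ i, Continuous (m i))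
    (hb : ∀ i x, ‖m i x‖ ≤ 1) (hl : ∀ x, Tendsto (fun i => m i x) l (𝓝 1)) :
    Tendsto (fun i => eLpNorm (fun u => h u - m i u • h u) 2 volume) l (𝓝 0) := by
  simp only [eLpNorm_eq_lintegral_rpow_enorm_toReal (p := 2) (by norm_num) (by norm_num)]
  have hfin := lintegral_rpow_enorm_lt_top_of_eLpNorm_lt_top (p := 2) (by norm_num) (by norm_num)
    (h2.const_smul (2 : ℝ)).eLpNorm_lt_top
  have key : Tendsto (fun i => ∫⁻ u, ‖h u - m i u • h u‖ₑ ^ (2 : ℝ≥0∞).toReal)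
      l (𝓝 (∫⁻ _ : ℝ, 0)) := by
    refine tendsto_lintegral_filter_of_dominated_convergence'
      (fun u => ‖((2 : ℝ) • h) u‖ₑ ^ (2 : ℝ≥0∞).toReal) (Eventually.of_forall fun i => ?_)
      (Eventually.of_forall fun i => ae_of_all _ fun u => ?_) hfin.ne (ae_of_all _ fun u => ?_)
    · exact (h2.1.sub ((hm i).aestronglyMeasurable.smul h2.1)).enorm.pow_const _
    · refine ENNReal.rpow_le_rpow ?_ (by simp)
      rw [← ofReal_norm, ← ofReal_norm]
      refine ENNReal.ofReal_le_ofReal ?_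
      refine (norm_sub_le _ _).trans ?_
      rw [norm_smul, Pi.smul_apply, norm_smul, Real.norm_of_nonneg zero_le_two]
      nlinarith [hb i u, norm_nonneg (h u)]
    · have h1 : Tendsto (fun i => h u - m i u • h u) l (𝓝 (h u - (1 : ℂ) • h u)) :=
        tendsto_const_nhds.sub ((hl u).smul_const _)
      rw [one_smul, sub_self] at h1
      have h3 := (ENNReal.continuous_rpow_const (y := (2 : ℝ≥0∞).toReal)).tendsto _ |>.comp h1.enorm
      simpa [Function.comp_def] using h3
  rw [lintegral_zero] at key
  have := (ENNReal.continuous_rpow_const (y := 1 / (2 : ℝ≥0∞).toReal)).tendsto 0 |>.comp key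
  simpa [Function.comp_def] using this

open Complex in
theorem continuous_regularizer (ε : ℝ) : Continuous fun x : ℝ => ((1 - ε * I * x : ℂ) ^ 3)⁻¹ := by
  refine Continuous.inv₀ (by fun_prop) fun x => pow_ne_zero _ ?_
  exact norm_pos_iff.1 (one_pos.trans_le (norm_le_one_sub_mul_I (ε := ε) (z := x) (by simp)).1)

open Complex in
theorem norm_regularizer_le_one (ε x : ℝ) : ‖((1 - ε * I * x : ℂ) ^ 3)⁻¹‖ ≤ 1 := by
  rw [norm_inv, norm_pow]
  exact inv_le_one_of_one_le₀
    (one_le_pow₀ (norm_le_one_sub_mul_I (ε := ε) (z := x) (by simp)).1)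

-- Being in L², the multiplier makes the regularization of an L² function integrable, so its
-- transform is a genuine integral.
open Complex in
theorem memLp_regularizer {ε : ℝ} (hε : ε ≠ 0) :
    MemLp (fun x : ℝ => ((1 - ε * I * x : ℂ) ^ 3)⁻¹) 2 volume := by
  rw [memLp_two_iff_integrable_sq_norm (continuous_regularizer ε).aestronglyMeasurable]
  refine (integrable_inv_one_add_sq.comp_mul_left' hε).mono'
    ((continuous_regularizer ε).norm.pow 2).aestronglyMeasurable (ae_of_all _ fun x => ?_)
  have h1 := (norm_le_one_sub_mul_I (ε := ε) (z := x) (by simp)).1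
  have h2 : ‖(1 - ε * I * x : ℂ)‖ ^ 2 = 1 + (ε * x) ^ 2 := by
    rw [norm_one_sub_mul_I_sq]
    simp [mul_pow]
  rw [norm_pow, norm_norm, norm_inv, norm_pow, inv_pow, ← h2]
  gcongr
  exact le_self_pow₀ h1 (by norm_num)

-- The hypothesis on ξ reads 2πξ ≤ -B for ε > 0 and 2πξ ≥ B for ε < 0. The second case reduces to
-- the first by z ↦ -z, which swaps the half-planes.
open Complex in
theorem fourier_regularized_eq_zero {f : ℂ → E} (hf : Differentiable ℂ f) {B M : ℝ}
    (hM : ∀ z, ‖f z‖ ≤ M * (2 + ‖z‖) * Real.exp (B * |z.im|)) {ε ξ : ℝ} (hε : ε ≠ 0)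
    (hξ : B * |ε| ≤ -(ε * (2 * Real.pi * ξ))) :
    𝓕 (fun x : ℝ => ((1 - ε * I * x : ℂ) ^ 3)⁻¹ • f x) ξ = 0 := by
  rw [Real.fourier_eq']
  rcases lt_or_gt_of_ne hε with h0 | h0
  · have h1 : -(2 * Real.pi * ξ) ≤ -B := by
      rw [abs_of_neg h0] at hξ
      nlinarith
    have := integral_regularized_eq_zero (f := fun z => f (-z)) (B := B) (M := M) (by fun_prop)
      (fun z => by simpa using hM (-z)) (neg_pos.2 h0) h1
    rw [← this, ← integral_neg_eq_self]
    congr 1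
    funext x
    rw [smul_smul]
    congr 2
    · congr 1
      simp
      ring
    · simp
    · simp
  · have h1 : 2 * Real.pi * ξ ≤ -B := by
      rw [abs_of_pos h0] at hξ
      nlinarith
    have := integral_regularized_eq_zero hf hM h0 h1
    rw [← this]
    congr 1
    funext x
    rw [smul_smul]
    congr 3
    simp
    ring

theorem integral_exp_smul_eq_fourier {E : Type*} [NormedAddCommGroup E] [NormedSpace ℂ E]
    (k : ℝ → E) (w : ℝ) :
    ∫ u : ℝ, Complex.exp ((-(u * w) : ℝ) * Complex.I) • k u = 𝓕 k (w / (2 * Real.pi)) := by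
  rw [Real.fourier_eq']
  congr 1
  funext u
  congr 2
  push_cast
  simp
  field_simp

end Regularization

/-! ### Plancherel and the direct Paley–Wiener theorem -/

section PlancherelAux

open scoped FourierTransform SchwartzMap ENNReal

variable {E : Type*} [NormedAddCommGroup E] [InnerProductSpace ℂ E] [CompleteSpace E]

/-- Plancherel applied to h - k; integrability of `k` identifies its L² transform with the Fourier
integral almost everywhere. -/
theorem eLpNorm_fourier_sub {h k : ℝ → E} (h2 : MemLp h 2 volume) (k1 : Integrable k)
    (k2 : MemLp k 2 volume) :
    AEStronglyMeasurable
      (fun ξ => (𝓕 (h2.toLp h) : Lp E 2 (volume : Measure ℝ)) ξ - 𝓕 k ξ) volume ∧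
    eLpNorm (fun ξ => (𝓕 (h2.toLp h) : Lp E 2 (volume : Measure ℝ)) ξ - 𝓕 k ξ) 2 volume =
      eLpNorm (fun u => h u - k u) 2 volume := by
  have b : (fun ξ => (𝓕 (h2.toLp h) : Lp E 2 (volume : Measure ℝ)) ξ - 𝓕 k ξ) =ᵐ[volume]
      (𝓕 (h2.toLp h - k2.toLp _) : Lp E 2 (volume : Measure ℝ)) := by
    have : (𝓕 (h2.toLp h - k2.toLp _) : Lp E 2 (volume : Measure ℝ)) =
        𝓕 (h2.toLp h) - 𝓕 (k2.toLp _) := (Lp.fourierTransformₗᵢ ℝ E).map_sub _ _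
    rw [this]
    filter_upwards [Cl.fourier_toLp_ae k1 k2,
      Lp.coeFn_sub (𝓕 (h2.toLp h) : Lp E 2 (volume : Measure ℝ)) (𝓕 (k2.toLp _))] with x hx hy
    rw [hy, Pi.sub_apply, hx]
  refine ⟨(Lp.aestronglyMeasurable _).congr b.symm, ?_⟩
  rw [eLpNorm_congr_ae b, ← Lp.enorm_def, ← ofReal_norm (𝓕 _ : Lp E 2 (volume : Measure ℝ)),
    Lp.norm_fourier_eq, ofReal_norm, ← MemLp.toLp_sub, Lp.enorm_toLp]
  rfl

theorem memLp_fourier_rescaled {h : ℝ → E} (h2 : MemLp h 2 volume) :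
    MemLp (fun w => (√(2 * Real.pi))⁻¹ •
      (𝓕 (h2.toLp h) : Lp E 2 (volume : Measure ℝ)) (w / (2 * Real.pi))) 2 volume := by
  obtain ⟨a1, a2⟩ := Cl.eLpNorm_comp_div _
    (Lp.aestronglyMeasurable (𝓕 (h2.toLp h) : Lp E 2 (volume : Measure ℝ)))
  refine MemLp.const_smul ⟨a1, ?_⟩ _
  rw [a2]
  exact ENNReal.mul_lt_top (ENNReal.rpow_lt_top_of_nonneg (by simp) ENNReal.ofReal_ne_top)
    (Lp.eLpNorm_lt_top _)

/-- The rescaled `L²` Fourier transform is the `L²` limit of the transforms of truncations. -/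
theorem tendsto_fourier_truncate {h : ℝ → E} (h2 : MemLp h 2 volume) :
    Tendsto (fun T : ℝ => eLpNorm (fun w => (√(2 * Real.pi))⁻¹ •
        (𝓕 (h2.toLp h) : Lp E 2 (volume : Measure ℝ)) (w / (2 * Real.pi)) - (√(2 * Real.pi))⁻¹ •
        ∫ u : ℝ, Complex.exp ((-(u * w) : ℝ) * Complex.I) • (Set.Icc (-T) T).indicator h u) 2 volume)
        atTop (𝓝 0) := by
  set c : ℝ := (√(2 * Real.pi))⁻¹
  set G : Lp E 2 (volume : Measure ℝ) := 𝓕 (h2.toLp h) with hG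
  have key : ∀ T : ℝ, eLpNorm (fun w => c • G (w / (2 * Real.pi)) - c •
        ∫ u : ℝ, Complex.exp ((-(u * w) : ℝ) * Complex.I) • (Set.Icc (-T) T).indicator h u) 2 volume =
      ‖c‖ₑ * (ENNReal.ofReal (2 * Real.pi) ^ (1 / (2 : ℝ≥0∞).toReal) *
        eLpNorm (fun u => h u - (Set.Icc (-T) T).indicator h u) 2 volume) := by
    intro T
    have hT1 : Integrable ((Set.Icc (-T) T).indicator h) :=
      (integrable_indicator_iff measurableSet_Icc).2
        ((h2.locallyIntegrable (by norm_num)).integrableOn_isCompact isCompact_Icc)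
    have b1 : (fun w => c • G (w / (2 * Real.pi)) - c •
        ∫ u : ℝ, Complex.exp ((-(u * w) : ℝ) * Complex.I) • (Set.Icc (-T) T).indicator h u) =
        c • fun w => (fun ξ => G ξ - 𝓕 ((Set.Icc (-T) T).indicator h) ξ) (w / (2 * Real.pi)) := by
      funext w
      simp only [Pi.smul_apply, smul_sub]
      rw [integral_exp_smul_eq_fourier]
    obtain ⟨m1, m2⟩ := eLpNorm_fourier_sub h2 hT1 (h2.indicator measurableSet_Icc)
    rw [b1, eLpNorm_const_smul, (Cl.eLpNorm_comp_div _ m1).2, m2]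
  simp only [key]
  have h3 := ENNReal.Tendsto.const_mul (a := ENNReal.ofReal (2 * Real.pi) ^ (1 / (2 : ℝ≥0∞).toReal))
    (Cl.tendsto_truncate h2)
    (Or.inr (ENNReal.rpow_lt_top_of_nonneg (by simp) ENNReal.ofReal_ne_top).ne)
  have h4 := ENNReal.Tendsto.const_mul (a := ‖c‖ₑ) h3 (Or.inr (by simp))
  simpa using h4

open Complex in
/-- **Paley–Wiener**, direct part: the Fourier transform of a square integrable function of
exponential type has bounded support. -/
theorem fourier_eq_zero_of_exp_type {f : ℂ → E} (hf : Differentiable ℂ f) {B C : ℝ} (hB : 0 ≤ B)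
    (hC : ∀ z, ‖f z‖ ≤ C * Real.exp (B * ‖z‖)) (h2 : MemLp (fun x : ℝ => f x) 2 volume) :
    ∀ᵐ ξ : ℝ, B < |2 * Real.pi * ξ| →
      (𝓕 (h2.toLp _) : Lp E 2 (volume : Measure ℝ)) ξ = 0 := by
  obtain ⟨M, hM⟩ := exists_norm_le_of_exp_type_of_memLp hf hB hC h2
  set G : Lp E 2 (volume : Measure ℝ) := 𝓕 (h2.toLp _) with hG
  -- σ = 1 treats 2πξ < -B and σ = -1 treats 2πξ > B; the regularization parameter is ε = σt with t
  -- → 0⁺.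
  have key : ∀ σ : ℝ, |σ| = 1 → ∀ᵐ ξ : ℝ, B < -(σ * (2 * Real.pi * ξ)) → G ξ = 0 := by
    intro σ hσ
    set s : Set ℝ := {ξ | B < -(σ * (2 * Real.pi * ξ))} with hs
    have hsm : MeasurableSet s := (isOpen_lt continuous_const (by fun_prop)).measurableSet
    let m : Set.Ioi (0 : ℝ) → ℝ → ℂ := fun t x => ((1 - (σ * t : ℝ) * I * x : ℂ) ^ 3)⁻¹
    have hlim := tendsto_eLpNorm_sub_smul (l := comap ((↑) : Set.Ioi (0 : ℝ) → ℝ) (𝓝 0)) h2 (m := m)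
      (fun t => continuous_regularizer _) (fun t x => norm_regularizer_le_one _ _) (fun x => by
        have hc : ContinuousAt (fun t : ℝ => ((1 - (σ * t : ℝ) * I * x : ℂ) ^ 3)⁻¹) 0 :=
          ContinuousAt.inv₀ (by fun_prop) (by simp)
        have := hc.tendsto.comp (tendsto_comap (f := ((↑) : Set.Ioi (0 : ℝ) → ℝ)))
        simpa [m, Function.comp_def] using! this)
    -- On `s` the transform of the regularized function vanishes, so `G` there equals the difference
    -- of transforms, whose full L² norm is that of f - m f by Plancherel.
    have hle : ∀ t, eLpNorm (s.indicator G) 2 volume ≤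
        eLpNorm (fun u : ℝ => f u - m t u • f u) 2 volume := fun t => by
      have ht : σ * t ≠ 0 := mul_ne_zero (by rintro rfl; simp at hσ) (ne_of_gt t.2)
      have k2 : MemLp (fun x : ℝ => m t x • f x) 2 volume :=
        h2.mono ((continuous_regularizer _).aestronglyMeasurable.smul h2.1)
          (ae_of_all _ fun x => by
            rw [norm_smul]
            exact mul_le_of_le_one_left (norm_nonneg _) (norm_regularizer_le_one _ _))
      have k1 : Integrable (fun x : ℝ => m t x • f x) :=
        memLp_one_iff_integrable.1 (h2.smul (memLp_regularizer ht))
      rw [← (eLpNorm_fourier_sub h2 k1 k2).2]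
      refine eLpNorm_mono fun ξ => ?_
      by_cases hξ : ξ ∈ s
      · rw [Set.indicator_of_mem hξ]
        have hz := fourier_regularized_eq_zero hf hM ht (ξ := ξ) (by
          rw [abs_mul, hσ, one_mul, abs_of_pos t.2]
          have h1 : B < -(σ * (2 * Real.pi * ξ)) := hξ
          have h2 : (0 : ℝ) < t := t.2
          nlinarith)
        simp only [m, hz, sub_zero]
        exact le_rfl
      · rw [Set.indicator_of_notMem hξ, norm_zero]
        exact norm_nonneg _
    have : (comap ((↑) : Set.Ioi (0 : ℝ) → ℝ) (𝓝 0)).NeBot := by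
      rw [← mem_closure_iff_comap_neBot, closure_Ioi]
      exact Set.mem_Ici.2 le_rfl
    have h0 : eLpNorm (s.indicator G) 2 volume = 0 :=
      le_antisymm (ge_of_tendsto' hlim hle) zero_le
    rw [eLpNorm_eq_zero_iff ((Lp.aestronglyMeasurable G).indicator hsm) (by norm_num)] at h0
    filter_upwards [h0] with ξ h1 h2
    rwa [Set.indicator_of_mem (show ξ ∈ s from h2)] at h1
  filter_upwards [key 1 (by simp), key (-1) (by simp)] with ξ h1 h2 h3
  rcases lt_abs.1 h3 with h4 | h4
  · exact h2 (by linarith)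
  · exact h1 (by linarith)

end PlancherelAux

/-! ### L² estimates and holomorphy of band-limited integrals -/

section PaleyWienerConverse

open scoped FourierTransform SchwartzMap ENNReal

theorem quasiMeasurePreserving_mul_right_real {a : ℝ} (ha : a ≠ 0) :
    Measure.QuasiMeasurePreserving (fun x : ℝ => x * a) volume volume := by
  refine ⟨by fun_prop, ?_⟩
  rw [Real.map_volume_mul_right ha]
  exact Measure.smul_absolutelyContinuous

theorem integral_sq_norm_eq_of_eLpNorm_eq {E F : Type*} [NormedAddCommGroup E]
    [NormedAddCommGroup F] {g : ℝ → E} {h : ℝ → F} (hg : MemLp g 2 volume) (hh : MemLp h 2 volume)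
    (e : eLpNorm g 2 volume = eLpNorm h 2 volume) : ∫ x, ‖g x‖ ^ 2 = ∫ x, ‖h x‖ ^ 2 := by
  rw [hg.eLpNorm_eq_integral_rpow_norm (by norm_num) (by norm_num),
    hh.eLpNorm_eq_integral_rpow_norm (by norm_num) (by norm_num),
    ENNReal.ofReal_eq_ofReal_iff (by positivity) (by positivity)] at e
  have := congrArg (fun t : ℝ => t ^ 2) e
  simp only [ENNReal.toReal_ofNat, Real.rpow_two, ← Real.sqrt_eq_rpow, ← one_div] at this
  simp only [← Real.rpow_natCast] at this
  norm_num [← Real.sqrt_eq_rpow] at this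
  rwa [Real.sqrt_inj (integral_nonneg fun x => by positivity)
    (integral_nonneg fun x => by positivity)] at this

theorem integrableOn_of_memLp_two {E : Type*} [NormedAddCommGroup E] {g : ℝ → E}
    (hg : MemLp g 2 volume) (a b : ℝ) : IntegrableOn g (Set.Icc a b) :=
  (hg.locallyIntegrable (by norm_num)).integrableOn_isCompact isCompact_Icc

theorem setIntegral_norm_le_of_memLp_two {E : Type*} [NormedAddCommGroup E] {g : ℝ → E}
    (hg : MemLp g 2 volume) {B : ℝ} (hB : 0 ≤ B) :
    ∫ w in Set.Ioc (-B) B, ‖g w‖ ≤ 2 * B + ∫ w, ‖g w‖ ^ 2 := by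
  have hi : Integrable fun w => ‖g w‖ ^ 2 := hg.integrable_norm_pow (by norm_num)
  have h1 : IntegrableOn (fun w => ‖g w‖) (Set.Ioc (-B) B) :=
    ((integrableOn_of_memLp_two hg (-B) B).mono_set Set.Ioc_subset_Icc_self).norm
  have hc : IntegrableOn (fun _ : ℝ => (1 : ℝ)) (Set.Ioc (-B) B) :=
    integrableOn_const (by simp) (by simp)
  calc ∫ w in Set.Ioc (-B) B, ‖g w‖ ≤ ∫ w in Set.Ioc (-B) B, (1 + ‖g w‖ ^ 2) :=
        setIntegral_mono h1 (hc.add hi.integrableOn) fun t => by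
          nlinarith [sq_nonneg (‖g t‖ - 1), sq_nonneg ‖g t‖]
    _ = 2 * B + ∫ w in Set.Ioc (-B) B, ‖g w‖ ^ 2 := by
        rw [integral_add hc hi.integrableOn]
        simp [Measure.real]
        rw [ENNReal.toReal_ofReal (by linarith)]
        ring
    _ ≤ _ := add_le_add_right
        (setIntegral_le_integral hi (ae_of_all _ fun t => by positivity)) _

variable {E : Type*} [NormedAddCommGroup E] [NormedSpace ℂ E]

open Complex in
theorem norm_exp_I_mul_le {z : ℂ} {B w : ℝ} (hw : w ∈ Set.Ioc (-B) B) :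
    ‖exp (I * z * w)‖ ≤ Real.exp (B * ‖z‖) := by
  rw [Complex.norm_exp]
  gcongr
  refine (le_abs_self _).trans ((abs_re_le_norm _).trans ?_)
  rw [norm_mul, norm_mul, norm_I, one_mul, norm_real, mul_comm]
  gcongr
  exact abs_le.2 ⟨hw.1.le, hw.2⟩

open Complex in
theorem differentiable_integral_exp_smul {Γ : ℝ → E} {B : ℝ}
    (hΓ : IntegrableOn Γ (Set.Ioc (-B) B)) :
    Differentiable ℂ fun z : ℂ => ∫ w in Set.Ioc (-B) B, exp (I * z * w) • Γ w := by
  intro z₀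
  have hm : ∀ z : ℂ, AEStronglyMeasurable (fun w : ℝ => exp (I * z * w) • Γ w)
      (volume.restrict (Set.Ioc (-B) B)) := fun z =>
    (by fun_prop : Continuous fun w : ℝ => exp (I * z * w)).aestronglyMeasurable.smul hΓ.1
  have h := hasDerivAt_integral_of_dominated_loc_of_deriv_le
    (μ := volume.restrict (Set.Ioc (-B) B)) (F := fun (z : ℂ) (w : ℝ) => exp (I * z * w) • Γ w)
    (F' := fun (z : ℂ) (w : ℝ) => (exp (I * z * w) * (I * w)) • Γ w) (x₀ := z₀)
    (s := Metric.ball z₀ 1)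
    (bound := fun w => Real.exp (B * (‖z₀‖ + 1)) * B * ‖Γ w‖)
    (Metric.ball_mem_nhds _ one_pos) (Eventually.of_forall hm) ?_ ?_ ?_ ?_ ?_
  · exact h.2.differentiableAt
  · refine (hΓ.norm.const_mul (Real.exp (B * ‖z₀‖))).mono' (hm _) ?_
    filter_upwards [ae_restrict_mem measurableSet_Ioc] with w hw
    rw [norm_smul]
    gcongr
    exact norm_exp_I_mul_le hw
  · exact (by fun_prop : Continuous fun w : ℝ =>
      exp (I * z₀ * w) * (I * w)).aestronglyMeasurable.smul hΓ.1
  · filter_upwards [ae_restrict_mem measurableSet_Ioc] with w hw z hz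
    have hB : 0 ≤ B := by linarith [hw.1, hw.2]
    have hz1 : ‖z‖ ≤ ‖z₀‖ + 1 := by
      have := norm_add_le z₀ (z - z₀)
      rw [add_sub_cancel] at this
      have h2 : ‖z - z₀‖ < 1 := by simpa [dist_eq_norm] using hz
      linarith
    rw [norm_smul, norm_mul, norm_mul, norm_I, one_mul, norm_real]
    gcongr
    · exact (norm_exp_I_mul_le hw).trans (by gcongr)
    · exact abs_le.2 ⟨hw.1.le, hw.2⟩
  · exact hΓ.norm.const_mul _
  · filter_upwards with w z _
    refine HasDerivAt.smul_const ?_ _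
    have : HasDerivAt (fun z : ℂ => I * z * w) (I * w) z := by
      simpa using ((hasDerivAt_id z).const_mul I).mul_const (w : ℂ)
    exact this.cexp

end PaleyWienerConverse

/-! ### The converse Paley–Wiener theorem -/

section PaleyWienerConverse

open scoped FourierTransform SchwartzMap ENNReal

variable {E : Type*} [NormedAddCommGroup E] [InnerProductSpace ℂ E] [CompleteSpace E]

/-- The L² inverse transform and the inverse Fourier integral define the same tempered distribution;
testing against smooth compactly supported functions identifies them almost everywhere. -/
theorem fourierInv_toLp_ae {h : ℝ → E} (h1 : Integrable h) (h2 : MemLp h 2 volume) :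
    ((𝓕⁻ (h2.toLp h) : Lp E 2 (volume : Measure ℝ)) : ℝ → E) =ᵐ[volume] 𝓕⁻ h := by
  have hc : Continuous (𝓕⁻ h) :=
    VectorFourier.fourierIntegral_continuous Real.continuous_fourierChar
      (L := -innerₗ ℝ) (by simp only [LinearMap.neg_apply]; fun_prop) h1
  refine ae_eq_of_integral_contDiff_smul_eq
    ((Lp.memLp _).locallyIntegrable (by norm_num)) hc.locallyIntegrable fun g gs gc => ?_
  have hg₁ : HasCompactSupport (Complex.ofRealCLM ∘ g) := gc.comp_left rfl
  have hg₂ : ContDiff ℝ (⊤ : ℕ∞) (Complex.ofRealCLM ∘ g) := by fun_prop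
  set φ : 𝓢(ℝ, ℂ) := hg₁.toSchwartzMap hg₂ with hφ
  have e1 := congrArg (fun S => S φ) (Lp.fourierInv_toTemperedDistribution_eq (h2.toLp h))
  simp only [TemperedDistribution.fourierInv_apply, Lp.toTemperedDistribution_apply] at e1
  have e2 : ∫ x, (𝓕⁻ φ) x • (h2.toLp h) x = ∫ x, (𝓕⁻ φ) x • h x := by
    apply integral_congr_ae
    filter_upwards [h2.coeFn_toLp] with x hx
    rw [hx]
  have e3 := VectorFourier.integral_fourierIntegral_smul_eq_flip (L := -innerₗ ℝ) (μ := volume)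
    (ν := volume) Real.continuous_fourierChar
    (by simp only [LinearMap.neg_apply]; fun_prop) φ.integrable h1
  have e5 : (-innerₗ ℝ : ℝ →ₗ[ℝ] ℝ →ₗ[ℝ] ℝ).flip = -innerₗ ℝ := by
    ext
    simp
  have e4 : ∫ x, (𝓕⁻ φ) x • h x = ∫ x, φ x • 𝓕⁻ h x := by
    rw [e5] at e3
    rw [SchwartzMap.fourierInv_coe]
    exact e3
  exact e1.symm.trans (e2.trans e4)

open Complex in
/-- **Paley–Wiener**, converse part. -/
theorem eq_integral_of_fourier_eq_zero {f : ℂ → E} (hf : Differentiable ℂ f) {B : ℝ}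
    (h2 : MemLp (fun x : ℝ => f x) 2 volume) {Γ : ℝ → E}
    (hΓ : Γ =ᵐ[volume] fun w => (√(2 * Real.pi))⁻¹ •
      (𝓕 (h2.toLp _) : Lp E 2 (volume : Measure ℝ)) (w / (2 * Real.pi)))
    (h0 : ∀ᵐ w : ℝ, B < |w| → Γ w = 0) (z : ℂ) :
    f z = (√(2 * Real.pi))⁻¹ • ∫ w in Set.Ioc (-B) B, exp (I * z * w) • Γ w := by
  set c : ℝ := (√(2 * Real.pi))⁻¹ with hc
  have hpi : (2 * Real.pi) ≠ 0 := by positivity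
  -- One factor c comes from the inversion formula and one from the definition of Γ; their product
  -- cancels the Jacobian 2π of w = 2πξ.
  have hcc : c * c = (2 * Real.pi)⁻¹ := by
    rw [hc, ← mul_inv, Real.mul_self_sqrt (by positivity)]
  have hc0 : c ≠ 0 := by positivity
  set G : Lp E 2 (volume : Measure ℝ) := 𝓕 (h2.toLp _) with hG
  have hΓ2 : MemLp Γ 2 volume := (memLp_congr_ae hΓ).2 (memLp_fourier_rescaled h2)
  have hΓi : IntegrableOn Γ (Set.Icc (-B) B) := integrableOn_of_memLp_two hΓ2 _ _
  have hΓs : Γ =ᵐ[volume] (Set.Icc (-B) B).indicator Γ := by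
    filter_upwards [h0] with w hw
    by_cases hwB : w ∈ Set.Icc (-B) B
    · rw [Set.indicator_of_mem hwB]
    · rw [Set.indicator_of_notMem hwB]
      exact hw (not_le.1 fun h => hwB ⟨(abs_le.1 h).1, (abs_le.1 h).2⟩)
  -- L² on a bounded interval lies in L¹, so inversion holds with an actual integral.
  have hΓi' : Integrable Γ :=
    ((integrable_indicator_iff measurableSet_Icc).2 hΓi).congr hΓs.symm
  have hGΓ : (fun ξ => c⁻¹ • Γ (ξ * (2 * Real.pi))) =ᵐ[volume] G := by
    filter_upwards [(quasiMeasurePreserving_mul_right_real hpi).ae hΓ] with ξ hξ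
    rw [hξ, smul_smul, inv_mul_cancel₀ hc0, one_smul, mul_div_assoc, div_self hpi, mul_one]
  have hG1 : Integrable (G : ℝ → E) :=
    ((hΓi'.comp_mul_right' hpi).smul c⁻¹).congr hGΓ
  have hinv := fourierInv_toLp_ae hG1 (Lp.memLp G)
  rw [Lp.toLp_coeFn, hG, FourierTransform.fourierInv_fourier_eq] at hinv
  have hval : ∀ x : ℝ, 𝓕⁻ (G : ℝ → E) x = c • ∫ w in Set.Ioc (-B) B, exp (I * x * w) • Γ w := by
    intro x
    rw [Real.fourierInv_eq', ← integral_Icc_eq_integral_Ioc]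
    have e1 : ∫ w in Set.Icc (-B) B, exp (I * x * w) • Γ w = ∫ w : ℝ, exp (I * x * w) • Γ w := by
      rw [← integral_indicator measurableSet_Icc]
      refine integral_congr_ae ?_
      filter_upwards [hΓs] with w hw
      conv_rhs => rw [hw]
      by_cases hwB : w ∈ Set.Icc (-B) B <;> simp [hwB]
    obtain ⟨g, hg⟩ : ∃ g : ℝ → E, g = fun ξ : ℝ => exp (2 * Real.pi * I * x * ξ) • G ξ := ⟨_, rfl⟩
    have e2 : ∫ w : ℝ, exp (I * x * w) • Γ w = c • ∫ w : ℝ, g (w / (2 * Real.pi)) := by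
      rw [← integral_smul]
      refine integral_congr_ae ?_
      filter_upwards [hΓ] with w hw
      rw [hw, hg, smul_comm c]
      congr 2
      push_cast
      field_simp
    rw [e1, e2, Measure.integral_comp_div, smul_smul, smul_smul, hcc, abs_of_pos (by positivity),
      inv_mul_cancel₀ hpi, one_smul, hg]
    congr 1
    funext ξ
    congr 2
    simp
    ring
  have hcont : Continuous fun x : ℝ => f x := hf.continuous.comp continuous_ofReal
  have hd := (differentiable_integral_exp_smul
    (hΓi.mono_set Set.Ioc_subset_Icc_self)).const_smul c
  have hae : (fun x : ℝ => f x) =ᵐ[volume]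
      fun x : ℝ => c • ∫ w in Set.Ioc (-B) B, exp (I * x * w) • Γ w := by
    filter_upwards [hinv, h2.coeFn_toLp] with x hx1 hx2
    rw [← hx2, hx1, ← hval]
  have heq : (fun x : ℝ => f x) =
      fun x : ℝ => c • ∫ w in Set.Ioc (-B) B, exp (I * x * w) • Γ w :=
    (Continuous.ae_eq_iff_eq volume hcont (hd.continuous.comp continuous_ofReal)).1 hae
  -- Identity theorem: the two entire functions agree on ℝ, which accumulates at 0.
  have hfinal := AnalyticOnNhd.eq_of_frequently_eq (z₀ := (0 : ℂ))
    (analyticOnNhd_univ_iff_differentiable.2 hf) (analyticOnNhd_univ_iff_differentiable.2 hd) (by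
      have ht : Tendsto (fun x : ℝ => (x : ℂ)) (𝓝[≠] 0) (𝓝[≠] 0) := by
        refine tendsto_nhdsWithin_of_tendsto_nhds_of_eventually_within _ ?_ ?_
        · have := continuous_ofReal.tendsto 0
          rw [ofReal_zero] at this
          exact this.mono_left nhdsWithin_le_nhds
        · filter_upwards [self_mem_nhdsWithin] with x hx
          simpa using hx
      exact ht.frequently (Frequently.of_forall fun x => congrFun heq x))
  exact congrFun hfinal z

/-- Plancherel in the unitary normalization: the squared prefactor 1/(2π) cancels the Jacobian of w
↦ w/(2π). -/
theorem integral_sq_norm_fourier_rescaled {h : ℝ → E} (h2 : MemLp h 2 volume) {Γ : ℝ → E}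
    (hΓ : Γ =ᵐ[volume] fun w => (√(2 * Real.pi))⁻¹ •
      (𝓕 (h2.toLp _) : Lp E 2 (volume : Measure ℝ)) (w / (2 * Real.pi))) :
    ∫ w, ‖Γ w‖ ^ 2 = ∫ x, ‖h x‖ ^ 2 := by
  set G : Lp E 2 (volume : Measure ℝ) := 𝓕 (h2.toLp _) with hG
  obtain ⟨g, hg⟩ : ∃ g : ℝ → ℝ, g = fun ξ => (2 * Real.pi)⁻¹ * ‖G ξ‖ ^ 2 := ⟨_, rfl⟩
  have e1 : ∫ w, ‖Γ w‖ ^ 2 = ∫ w, g (w / (2 * Real.pi)) := by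
    refine integral_congr_ae ?_
    filter_upwards [hΓ] with w hw
    rw [hw, hg, norm_smul, mul_pow, Real.norm_of_nonneg (by positivity), inv_pow,
      Real.sq_sqrt (by positivity)]
  rw [e1, Measure.integral_comp_div, hg, integral_const_mul, abs_of_pos (by positivity), smul_eq_mul,
    ← mul_assoc, mul_inv_cancel₀ (by positivity), one_mul]
  refine integral_sq_norm_eq_of_eLpNorm_eq (Lp.memLp G) h2 ?_
  rw [← Lp.enorm_def, ← ofReal_norm G, hG, Lp.norm_fourier_eq, ofReal_norm, Lp.enorm_toLp]

-- On |w| ≤ B the kernel is at most e^{B|z|}, and ∫‖Γ‖ over [-B, B] is at most 2B + ∫‖Γ‖² = 2B +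
-- ∫‖f‖². The explicit constant is what later allows uniformity over slices.
open Complex in
theorem norm_le_of_fourier_eq_zero {f : ℂ → E} (hf : Differentiable ℂ f) {B : ℝ} (hB : 0 < B)
    (h2 : MemLp (fun x : ℝ => f x) 2 volume) {Γ : ℝ → E}
    (hΓ : Γ =ᵐ[volume] fun w => (√(2 * Real.pi))⁻¹ •
      (𝓕 (h2.toLp _) : Lp E 2 (volume : Measure ℝ)) (w / (2 * Real.pi)))
    (h0 : ∀ᵐ w : ℝ, B < |w| → Γ w = 0) (z : ℂ) :
    ‖f z‖ ≤ (√(2 * Real.pi))⁻¹ * (2 * B + ∫ x : ℝ, ‖f x‖ ^ 2) * Real.exp (B * ‖z‖) := by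
  have hΓ2 : MemLp Γ 2 volume := (memLp_congr_ae hΓ).2 (memLp_fourier_rescaled h2)
  have hi : IntegrableOn Γ (Set.Ioc (-B) B) :=
    (integrableOn_of_memLp_two hΓ2 _ _).mono_set Set.Ioc_subset_Icc_self
  rw [eq_integral_of_fourier_eq_zero hf h2 hΓ h0 z, norm_smul,
    Real.norm_of_nonneg (by positivity), mul_assoc, ← integral_sq_norm_fourier_rescaled h2 hΓ]
  gcongr
  calc ‖∫ w in Set.Ioc (-B) B, exp (I * z * w) • Γ w‖ ≤
      ∫ w in Set.Ioc (-B) B, Real.exp (B * ‖z‖) * ‖Γ w‖ := by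
        refine norm_integral_le_of_norm_le (hi.norm.const_mul _) ?_
        filter_upwards [ae_restrict_mem measurableSet_Ioc] with w hw
        rw [norm_smul]
        gcongr
        exact norm_exp_I_mul_le hw
    _ = (∫ w in Set.Ioc (-B) B, ‖Γ w‖) * Real.exp (B * ‖z‖) := by
        rw [integral_const_mul, mul_comm]
    _ ≤ _ := by
        gcongr
        exact setIntegral_norm_le_of_memLp_two hΓ2 hB.le

end PaleyWienerConverse

/-! ### Complexification and the splitting map -/

namespace Cl

variable {n : ℕ}

/-- Left multiplication as a continuous bilinear map. -/
noncomputable def mulL (n : ℕ) : Cl n →L[ℝ] Cl n →L[ℝ] Cl n :=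
  LinearMap.toContinuousLinearMap
    ((LinearMap.toContinuousLinearMap :
      (Cl n →ₗ[ℝ] Cl n) ≃ₗ[ℝ] (Cl n →L[ℝ] Cl n)).toLinearMap ∘ₗ LinearMap.mul ℝ (Cl n))

/-- The inclusion of `ℝ_n` into its complexification, in the coordinates of the basis `e_A`. -/
noncomputable def complexify (n : ℕ) : Cl n →L[ℝ] EuclideanSpace ℂ (Finset (Fin n)) :=
  LinearMap.toContinuousLinearMap
    ((WithLp.linearEquiv 2 ℝ (Finset (Fin n) → ℂ)).symm.toLinearMap ∘ₗ
      LinearMap.pi fun A => Complex.ofRealCLM.toLinearMap ∘ₗ (basis n).coord A)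

@[simp]
theorem complexify_apply (a : Cl n) (A : Finset (Fin n)) :
    complexify n a A = ((basis n).repr a A : ℂ) := rfl

/-- The real part of an element of the complexification of `ℝ_n`. -/
noncomputable def rePart (n : ℕ) : EuclideanSpace ℂ (Finset (Fin n)) →L[ℝ] Cl n :=
  LinearMap.toContinuousLinearMap
    (∑ A, LinearMap.toSpanSingleton ℝ (Cl n) (basis n A) ∘ₗ Complex.reCLM.toLinearMap ∘ₗ
      (LinearMap.proj A : (Finset (Fin n) → ℂ) →ₗ[ℝ] ℂ) ∘ₗ
      (WithLp.linearEquiv 2 ℝ (Finset (Fin n) → ℂ)).toLinearMap)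

theorem rePart_apply (y : EuclideanSpace ℂ (Finset (Fin n))) :
    rePart n y = ∑ A, (y A).re • basis n A := by
  simp [rePart]

/-- The embedding `a ↦ a - i I a` of `ℝ_n` into its complexification, which turns left
multiplication by `I` into multiplication by `i`. -/
noncomputable def splitting (I : EuclideanSpace ℝ (Fin n)) :
    Cl n →L[ℝ] EuclideanSpace ℂ (Finset (Fin n)) :=
  complexify n - Complex.I • (complexify n ∘L mulL n (vec I))

theorem splitting_apply (I : EuclideanSpace ℝ (Fin n)) (a : Cl n) :
    splitting I a = complexify n a - Complex.I • complexify n (vec I * a) := rfl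

/-- In the real basis the term iIa has purely imaginary coordinates. This left inverse carries
complex-valued identities back to the Clifford algebra. -/
theorem rePart_splitting (I : EuclideanSpace ℝ (Fin n)) (a : Cl n) :
    rePart n (splitting I a) = a := by
  rw [rePart_apply]
  conv_rhs => rw [← (basis n).sum_repr a]
  simp [splitting_apply]

theorem splitting_injective (I : EuclideanSpace ℝ (Fin n)) : Function.Injective (splitting I) :=
  Function.LeftInverse.injective (rePart_splitting I)

/-- Since I² = -1, Ia - iI(Ia) = Ia + ia = i(a - iIa). -/
theorem splitting_vec_mul {I : EuclideanSpace ℝ (Fin n)} (hI : ‖I‖ = 1) (a : Cl n) :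
    splitting I (vec I * a) = Complex.I • splitting I a := by
  rw [splitting_apply, splitting_apply, ← mul_assoc, vec_mul_self hI, neg_one_mul, map_neg,
    smul_sub, smul_smul, Complex.I_mul_I, neg_one_smul, smul_neg]
  abel

theorem splitting_ofComplex_mul {I : EuclideanSpace ℝ (Fin n)} (hI : ‖I‖ = 1) (z : ℂ) (a : Cl n) :
    splitting I (ofComplex I hI z * a) = z • splitting I a := by
  have h : ofComplex I hI z * a = z.re • a + z.im • (vec I * a) := by
    simp [ofComplex, Complex.liftAux_apply, add_mul, Algebra.smul_def, mul_assoc]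
  rw [h, map_add, map_smul, map_smul, splitting_vec_mul hI]
  conv_rhs => rw [← Complex.re_add_im z, add_smul, mul_smul, Complex.coe_smul, Complex.coe_smul]

/-- The growth condition asks for a single constant over all slices, so the bound must not depend on
`I`. -/
theorem exists_norm_splitting_le (n : ℕ) :
    ∃ K : ℝ, 0 ≤ K ∧ ∀ I : EuclideanSpace ℝ (Fin n), ‖I‖ = 1 → ∀ a : Cl n,
      ‖splitting I a‖ ≤ K * ‖a‖ := by
  let V : EuclideanSpace ℝ (Fin n) →L[ℝ] Cl n :=
    LinearMap.toContinuousLinearMap (CliffordAlgebra.ι (negSq n))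
  refine ⟨‖complexify n‖ * (1 + ‖mulL n‖ * ‖V‖), by positivity, fun I hI a => ?_⟩
  have h1 : ‖(vec I * a : Cl n)‖ ≤ ‖mulL n‖ * ‖V‖ * ‖a‖ := by
    have h2 := (mulL n).le_opNorm₂ (vec I) a
    have h3 := V.le_opNorm I
    rw [hI, mul_one] at h3
    refine h2.trans ?_
    gcongr
    exact h3
  rw [splitting_apply]
  refine (norm_sub_le _ _).trans ?_
  rw [norm_smul, Complex.norm_I, one_mul]
  calc ‖complexify n a‖ + ‖complexify n (vec I * a)‖ ≤
      ‖complexify n‖ * ‖a‖ + ‖complexify n‖ * (‖mulL n‖ * ‖V‖ * ‖a‖) :=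
        add_le_add ((complexify n).le_opNorm _) (((complexify n).le_opNorm _).trans (by gcongr))
    _ = _ := by ring

theorem exp_ofComplex {I : EuclideanSpace ℝ (Fin n)} (hI : ‖I‖ = 1) (z : ℂ) :
    NormedSpace.exp (ofComplex I hI z) = ofComplex I hI (Complex.exp z) := by
  have hm := (NormedSpace.exp_series_hasSum_exp' (𝕂 := ℝ) z).mapL
    (ofComplex I hI).toLinearMap.toContinuousLinearMap
  rw [← Complex.exp_eq_exp_ℂ] at hm
  rw [NormedSpace.exp_eq_tsum ℝ]
  refine HasSum.tsum_eq ?_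
  have he : (fun k : ℕ => ((Nat.factorial k : ℝ)⁻¹ • (ofComplex I hI z) ^ k : Cl n)) = fun k : ℕ =>
      ofComplex I hI ((Nat.factorial k : ℝ)⁻¹ • z ^ k) := by
    funext k
    rw [map_smul, map_pow]
  rw [he]
  exact hm

end Cl

/-! ### Slices of paravector space -/

namespace Paravector

variable {n : ℕ}

theorem norm_mk (u : ℝ) {I : EuclideanSpace ℝ (Fin n)} (hI : ‖I‖ = 1) (v : ℝ) :
    ‖mk u I v‖ = ‖(⟨u, v⟩ : ℂ)‖ := by
  rw [WithLp.prod_norm_eq_of_L2, Complex.norm_eq_sqrt_sq_add_sq]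
  simp [mk, norm_smul, hI]

theorem mk_zero (u : ℝ) (I : EuclideanSpace ℝ (Fin n)) : mk u I 0 = ofReal u := by
  simp [mk, ofReal]

theorem toCl_mk_eq_ofComplex (u : ℝ) {I : EuclideanSpace ℝ (Fin n)} (hI : ‖I‖ = 1) (v : ℝ) :
    (mk u I v).toCl = Cl.ofComplex I hI ⟨u, v⟩ := by
  rw [toCl_mk, Cl.ofComplex, Complex.liftAux_apply, Algebra.smul_def]
  congr 1
  exact (Algebra.commutes _ _).symm

/-- The parametrization `u + i v ↦ u + I v` of the slice `ℝ + Iℝ`. -/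
noncomputable def slice (I : EuclideanSpace ℝ (Fin n)) : ℂ →L[ℝ] Paravector n :=
  LinearMap.toContinuousLinearMap
    ((WithLp.linearEquiv 2 ℝ (ℝ × EuclideanSpace ℝ (Fin n))).symm.toLinearMap ∘ₗ
      (Complex.reCLM.toLinearMap.prod
        (LinearMap.toSpanSingleton ℝ _ I ∘ₗ Complex.imCLM.toLinearMap)))

theorem slice_apply (I : EuclideanSpace ℝ (Fin n)) (z : ℂ) : slice I z = mk z.re I z.im := rfl

end Paravector

/-! ### Slice restrictions and their transforms -/

section SliceFunctions

open Paravector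

/-- The restriction of `f` to a slice, as a function of a complex variable with values in the
complexification of `ℝ_n`. -/
noncomputable def sliceFun {n : ℕ} (I : EuclideanSpace ℝ (Fin n)) (f : Paravector n → Cl n)
    (z : ℂ) : EuclideanSpace ℂ (Finset (Fin n)) :=
  Cl.splitting I (f (slice I z))

theorem sliceFun_ofReal {n : ℕ} (I : EuclideanSpace ℝ (Fin n)) (f : Paravector n → Cl n) (x : ℝ) :
    sliceFun I f x = Cl.splitting I (f (ofReal x)) := by
  rw [sliceFun, slice_apply, Complex.ofReal_re, Complex.ofReal_im, mk_zero]

theorem IsLeftSliceMonogenicOn.differentiable_sliceFun {n : ℕ} {f : Paravector n → Cl n}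
    (hf : IsLeftSliceMonogenicOn f Set.univ) {I : EuclideanSpace ℝ (Fin n)} (hI : I ∈ S n) :
    Differentiable ℂ (sliceFun I f) := by
  intro z
  have hI1 : ‖I‖ = 1 := by simpa using hI
  have hfd : Differentiable ℝ f := differentiableOn_univ.1 hf.differentiableOn
  set D := fderiv ℝ f (slice I z) ∘L slice I with hD
  have h1 : HasFDerivAt (fun z => f (slice I z)) D z :=
    (hfd (slice I z)).hasFDerivAt.comp z (slice I).hasFDerivAt
  have h2 : HasFDerivAt (sliceFun I f) (Cl.splitting I ∘L D) z :=
    (Cl.splitting I).hasFDerivAt.comp z h1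
  rw [differentiableAt_complex_iff_differentiableAt_real]
  refine ⟨h2.differentiableAt, ?_⟩
  rw [h2.fderiv]
  have d1 : HasDerivAt (fun s : ℝ => f (Paravector.mk s I z.im)) (D 1) z.re := by
    have e : HasDerivAt (fun s : ℝ => (⟨s, z.im⟩ : ℂ)) 1 z.re := by
      have := (Complex.ofRealCLM.hasDerivAt (x := z.re)).add_const (z.im * Complex.I)
      simpa [Complex.mk_eq_add_mul_I] using! this
    exact HasFDerivAt.comp_hasDerivAt (f := fun s : ℝ => (⟨s, z.im⟩ : ℂ)) z.re h1 e
  have d2 : HasDerivAt (fun t : ℝ => f (Paravector.mk z.re I t)) (D Complex.I) z.im := by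
    have e : HasDerivAt (fun t : ℝ => (⟨z.re, t⟩ : ℂ)) Complex.I z.im := by
      have := ((Complex.ofRealCLM.hasDerivAt (x := z.im)).mul_const Complex.I).const_add (z.re : ℂ)
      simpa [Complex.mk_eq_add_mul_I] using! this
    exact HasFDerivAt.comp_hasDerivAt (f := fun t : ℝ => (⟨z.re, t⟩ : ℂ)) z.im h1 e
  have hcr := hf.cauchyRiemann I hI z.re z.im (Set.mem_univ _)
  rw [d1.deriv, d2.deriv, smul_eq_zero] at hcr
  have hcr' := hcr.resolve_left (by norm_num)
  -- Left multiplication of the Cauchy–Riemann equation D(1) + I D(i) = 0 by I; after splitting,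
  -- this is complex linearity of the derivative.
  have h3 : D Complex.I = Cl.vec I * D 1 := by
    have := congrArg (fun a => Cl.vec I * a) hcr'
    simp only [mul_add, mul_zero, ← mul_assoc, Cl.vec_mul_self hI1, neg_one_mul] at this
    exact (sub_eq_zero.1 ((sub_eq_add_neg _ _).trans this)).symm
  change Cl.splitting I (D Complex.I) = Complex.I • Cl.splitting I (D 1)
  rw [h3, Cl.splitting_vec_mul hI1]

/-- The union defining `essSupport` may be uncountable; the Lindelöf property of ℝ reduces it to a
countable one, so `g` vanishes almost everywhere on it. -/
theorem essSupport_subset_Icc_iff {n : ℕ} (g : ℝ → Cl n) (B : ℝ) :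
    essSupport g ⊆ Set.Icc (-B) B ↔ ∀ᵐ w : ℝ, B < |w| → g w = 0 := by
  have hIcc : ∀ w : ℝ, w ∉ Set.Icc (-B) B ↔ B < |w| := fun w => by
    rw [Set.mem_Icc, ← abs_le, not_le]
  constructor
  · intro h
    set 𝒱 := {V : Set ℝ | IsOpen V ∧ ∀ᵐ w ∂volume.restrict V, g w = 0} with h𝒱
    obtain ⟨T, hTc, hTs, hTu⟩ := TopologicalSpace.isOpen_sUnion_countable 𝒱 fun V hV => hV.1
    have : ∀ᵐ w : ℝ, ∀ V ∈ T, w ∈ V → g w = 0 := (ae_ball_iff hTc).2 fun V hV =>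
      (ae_restrict_iff' (hTs hV).1.measurableSet).1 (hTs hV).2
    filter_upwards [this] with w hw hB
    have h1 : w ∈ ⋃₀ 𝒱 := by
      by_contra hn
      exact (hIcc w).2 hB (h hn)
    rw [← hTu] at h1
    obtain ⟨V, hV, hwV⟩ := h1
    exact hw V hV hwV
  · intro h w hw
    by_contra hn
    refine hw ⟨(Set.Icc (-B) B)ᶜ, ⟨isClosed_Icc.isOpen_compl, ?_⟩, hn⟩
    rw [ae_restrict_iff' measurableSet_Icc.compl]
    filter_upwards [h] with x hx hx1
    exact hx ((hIcc x).1 hx1)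

open scoped FourierTransform

theorem continuous_integral_exp_smul {E : Type*} [NormedAddCommGroup E] [NormedSpace ℂ E]
    {k : ℝ → E} (hk : Integrable k) :
    Continuous fun w : ℝ => ∫ u : ℝ, Complex.exp ((-(u * w) : ℝ) * Complex.I) • k u := by
  simp only [integral_exp_smul_eq_fourier]
  have hc : Continuous (𝓕 k) :=
    VectorFourier.fourierIntegral_continuous Real.continuous_fourierChar (by fun_prop) hk
  fun_prop

/-- Both sides are L² limits of the same transforms of truncations, because the splitting is
bounded, commutes with integrals and turns e^{-Iuw} into e^{-iuw}. Uniqueness of limits gives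
equality almost everywhere. -/
theorem splitting_fourierL2_ae {n : ℕ} {I : EuclideanSpace ℝ (Fin n)} (hI : I ∈ S n) {g : ℝ → Cl n}
    (hg : MemLp g 2 volume) {h : ℝ → EuclideanSpace ℂ (Finset (Fin n))} (h2 : MemLp h 2 volume)
    (hh : ∀ x, h x = Cl.splitting I (g x)) :
    (fun w => Cl.splitting I (fourierL2 I g w)) =ᵐ[volume] fun w => (√(2 * Real.pi))⁻¹ •
      (𝓕 (h2.toLp h) : Lp (EuclideanSpace ℂ (Finset (Fin n))) 2 (volume : Measure ℝ))
        (w / (2 * Real.pi)) := by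
  have hI1 : ‖I‖ = 1 := by simpa using hI
  obtain ⟨m1, t1⟩ := fourierL2_spec hI hg
  have m2 := memLp_fourier_rescaled h2
  have t2 := tendsto_fourier_truncate h2
  set Γ := fun w => (√(2 * Real.pi))⁻¹ •
      (𝓕 (h2.toLp h) : Lp (EuclideanSpace ℂ (Finset (Fin n))) 2 (volume : Measure ℝ))
        (w / (2 * Real.pi)) with hΓ
  set τ : ℝ → ℝ → EuclideanSpace ℂ (Finset (Fin n)) := fun T w => (√(2 * Real.pi))⁻¹ •
        ∫ u : ℝ, Complex.exp ((-(u * w) : ℝ) * Complex.I) • (Set.Icc (-T) T).indicator h u with hτ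
  have hhi : ∀ T : ℝ, Integrable ((Set.Icc (-T) T).indicator h) := fun T =>
    (integrable_indicator_iff measurableSet_Icc).2 (integrableOn_of_memLp_two h2 _ _)
  have hτc : ∀ T, Continuous (τ T) := fun T =>
    (continuous_integral_exp_smul (hhi T)).const_smul (√(2 * Real.pi))⁻¹
  have hb : ∀ T w, τ T w = Cl.splitting I (Cl.fourierL1 I ((Set.Icc (-T) T).indicator g) w) := by
    intro T w
    have hpt : ∀ u, Complex.exp ((-(u * w) : ℝ) * Complex.I) • (Set.Icc (-T) T).indicator h u =
        Cl.splitting I (NormedSpace.exp (-(u * w) • Cl.vec I) * (Set.Icc (-T) T).indicator g u) :=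
      fun u => by
        rw [Cl.exp_smul_vec hI1, Cl.splitting_ofComplex_mul hI1]
        congr 1
        by_cases hu : u ∈ Set.Icc (-T) T <;> simp [hu, hh]
    rw [Cl.fourierL1, map_smul, ← ContinuousLinearMap.integral_comp_comm]
    · simp only [hτ, hpt]
    · have hi : Integrable fun u => Complex.exp ((-(u * w) : ℝ) * Complex.I) •
          (Set.Icc (-T) T).indicator h u := by
        refine (hhi T).norm.mono' ?_ (ae_of_all _ fun u => ?_)
        · exact (by fun_prop : Continuous fun u : ℝ =>
            Complex.exp ((-(u * w) : ℝ) * Complex.I)).aestronglyMeasurable.smul (hhi T).1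
        · rw [norm_smul, Complex.norm_exp_ofReal_mul_I, one_mul]
      -- Integrability of the Clifford-valued integrand is read off from its split image through the
      -- left inverse.
      have := (Cl.rePart n).integrable_comp hi
      simpa only [hpt, Cl.rePart_splitting] using this
  have m3 : MemLp (fun w => Cl.splitting I (fourierL2 I g w)) 2 volume :=
    (Cl.splitting I).comp_memLp' m1
  have t3 : Tendsto (fun T => eLpNorm (fun w => Cl.splitting I (fourierL2 I g w) - τ T w) 2 volume)
      atTop (𝓝 0) := by
    have := ENNReal.Tendsto.const_mul (a := (‖Cl.splitting I‖₊ : ENNReal)) t1 (Or.inr (by simp))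
    rw [mul_zero] at this
    refine tendsto_of_tendsto_of_tendsto_of_le_of_le tendsto_const_nhds this (fun _ => zero_le)
      fun T => ?_
    have := eLpNorm_le_nnreal_smul_eLpNorm_of_ae_le_mul (μ := volume) (c := ‖Cl.splitting I‖₊)
      (f := fun w => Cl.splitting I (fourierL2 I g w) - τ T w)
      (g := fun w => fourierL2 I g w - Cl.fourierL1 I ((Set.Icc (-T) T).indicator g) w)
      (ae_of_all _ fun w => by
        rw [hb, ← map_sub]
        exact (Cl.splitting I).le_opNorm _) 2
    simpa [ENNReal.smul_def] using this
  have t4 := t3.add t2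
  rw [add_zero] at t4
  have hle : ∀ T, eLpNorm (fun w => Cl.splitting I (fourierL2 I g w) - Γ w) 2 volume ≤
      eLpNorm (fun w => Cl.splitting I (fourierL2 I g w) - τ T w) 2 volume +
        eLpNorm (fun w => Γ w - τ T w) 2 volume := fun T => by
    have := eLpNorm_sub_le (μ := volume) (p := 2)
      (m3.1.sub (hτc T).aestronglyMeasurable) (m2.1.sub (hτc T).aestronglyMeasurable) (by norm_num)
    refine le_trans (le_of_eq ?_) this
    congr 1
    funext w
    simp
  have h0 : eLpNorm (fun w => Cl.splitting I (fourierL2 I g w) - Γ w) 2 volume = 0 :=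
    le_antisymm (ge_of_tendsto' t4 hle) zero_le
  replace h0 := (eLpNorm_eq_zero_iff (m3.1.sub m2.1) (by norm_num)).1 h0
  filter_upwards [h0] with w hw
  exact sub_eq_zero.1 hw

end SliceFunctions

/-! ### Paley–Wiener on each slice -/

section SlicePaleyWiener

open Paravector

variable {n : ℕ} {f : Paravector n → Cl n} {B : ℝ} {I : EuclideanSpace ℝ (Fin n)}

theorem memLp_sliceFun (hL2 : MemLp (fun u : ℝ => f (ofReal u)) 2 volume)
    (I : EuclideanSpace ℝ (Fin n)) : MemLp (fun x : ℝ => sliceFun I f x) 2 volume := by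
  simp only [sliceFun_ofReal]
  exact (Cl.splitting I).comp_memLp' hL2

theorem fourierL2_eq_zero_of_exp_type (hf : IsLeftSliceMonogenicOn f Set.univ)
    (hL2 : MemLp (fun u : ℝ => f (ofReal u)) 2 volume) (hB : 0 ≤ B) (hI : I ∈ S n) {C : ℝ}
    (hC : ∀ u v : ℝ, ‖f (Paravector.mk u I v)‖ ≤ C * Real.exp (B * ‖Paravector.mk u I v‖)) :
    ∀ᵐ w : ℝ, B < |w| → fourierL2 I (fun u : ℝ => f (ofReal u)) w = 0 := by
  have hI1 : ‖I‖ = 1 := by simpa using hI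
  have h2 := memLp_sliceFun hL2 I
  have hz : ∀ z, ‖sliceFun I f z‖ ≤ ‖Cl.splitting I‖ * C * Real.exp (B * ‖z‖) := fun z => by
    have h := hC z.re z.im
    rw [norm_mk _ hI1] at h
    refine ((Cl.splitting I).le_opNorm _).trans ?_
    rw [mul_assoc]
    gcongr
    exact h
  have h0 := fourier_eq_zero_of_exp_type (hf.differentiable_sliceFun hI) hB hz h2
  have hpi : (2 * Real.pi)⁻¹ ≠ 0 := by positivity
  filter_upwards [splitting_fourierL2_ae hI hL2 h2 (sliceFun_ofReal I f),
    (quasiMeasurePreserving_mul_right_real hpi).ae h0] with w hw1 hw2 hw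
  apply Cl.splitting_injective I
  rw [hw1, map_zero, div_eq_mul_inv, hw2, smul_zero]
  rwa [mul_comm w, ← mul_assoc, mul_inv_cancel₀ (by positivity), one_mul]

theorem ae_splitting_fourierL2_eq_zero
    (h0 : ∀ᵐ w : ℝ, B < |w| → fourierL2 I (fun u : ℝ => f (ofReal u)) w = 0) :
    ∀ᵐ w : ℝ, B < |w| → Cl.splitting I (fourierL2 I (fun u : ℝ => f (ofReal u)) w) = 0 := by
  filter_upwards [h0] with w hw hB
  rw [hw hB, map_zero]

theorem eq_integral_fourierL2 (hf : IsLeftSliceMonogenicOn f Set.univ)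
    (hL2 : MemLp (fun u : ℝ => f (ofReal u)) 2 volume) (hB : 0 ≤ B) (hI : I ∈ S n)
    (h0 : ∀ᵐ w : ℝ, B < |w| → fourierL2 I (fun u : ℝ => f (ofReal u)) w = 0) (u v : ℝ) :
    f (Paravector.mk u I v) = (√(2 * Real.pi))⁻¹ • ∫ w in (-B)..B,
      NormedSpace.exp (w • (Cl.vec I * (Paravector.mk u I v).toCl)) *
        fourierL2 I (fun u : ℝ => f (ofReal u)) w := by
  have hI1 : ‖I‖ = 1 := by simpa using hI
  set g := fourierL2 I (fun u : ℝ => f (ofReal u)) with hg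
  set z : ℂ := ⟨u, v⟩ with hz
  have h2 := memLp_sliceFun hL2 I
  have key := eq_integral_of_fourier_eq_zero (hf.differentiable_sliceFun hI) h2
    (splitting_fourierL2_ae hI hL2 h2 (sliceFun_ofReal I f)) (ae_splitting_fourierL2_eq_zero h0) z
  have hpt : ∀ w : ℝ, Complex.exp (Complex.I * z * w) • Cl.splitting I (g w) =
      Cl.splitting I (NormedSpace.exp (w • (Cl.vec I * (Paravector.mk u I v).toCl)) * g w) :=
    fun w => by
      have e : w • (Cl.vec I * (Paravector.mk u I v).toCl) =
          Cl.ofComplex I hI1 (Complex.I * z * w) := by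
        rw [toCl_mk_eq_ofComplex u hI1 v, mul_comm _ (w : ℂ), ← Complex.real_smul, map_smul, map_mul]
        congr 2
        simp [Cl.ofComplex, Complex.liftAux_apply]
      rw [e, Cl.exp_ofComplex, Cl.splitting_ofComplex_mul]
  have hi : IntegrableOn (fun w : ℝ => Complex.exp (Complex.I * z * w) • Cl.splitting I (g w))
      (Set.Ioc (-B) B) := by
    have hgi : IntegrableOn (fun w => Cl.splitting I (g w)) (Set.Ioc (-B) B) :=
      (integrableOn_of_memLp_two ((Cl.splitting I).comp_memLp' (fourierL2_spec hI hL2).1)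
        (-B) B).mono_set Set.Ioc_subset_Icc_self
    refine (hgi.norm.const_mul (Real.exp (B * ‖z‖))).mono' ?_ ?_
    · exact (by fun_prop : Continuous fun w : ℝ =>
        Complex.exp (Complex.I * z * w)).aestronglyMeasurable.smul hgi.1
    · filter_upwards [ae_restrict_mem measurableSet_Ioc] with w hw
      rw [norm_smul]
      gcongr
      exact norm_exp_I_mul_le hw
  -- The real part is a bounded real-linear left inverse of the splitting, so it passes inside the
  -- integral and returns the Clifford-valued formula.
  have h3 := congrArg (Cl.rePart n) key
  rw [sliceFun, Cl.rePart_splitting, map_smul, ← ContinuousLinearMap.integral_comp_comm _ hi] at h3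
  simp only [hpt, Cl.rePart_splitting] at h3
  rw [intervalIntegral.integral_of_le (by linarith)]
  exact h3

theorem exists_norm_le_of_fourierL2_eq_zero (hf : IsLeftSliceMonogenicOn f Set.univ)
    (hL2 : MemLp (fun u : ℝ => f (ofReal u)) 2 volume) (hB : 0 < B)
    (h0 : ∀ I ∈ S n, ∀ᵐ w : ℝ, B < |w| → fourierL2 I (fun u : ℝ => f (ofReal u)) w = 0) :
    ∃ C : ℝ, ∀ I ∈ S n, ∀ u v : ℝ,
      ‖f (Paravector.mk u I v)‖ ≤ C * Real.exp (B * ‖Paravector.mk u I v‖) := by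
  obtain ⟨K, hK0, hK⟩ := Cl.exists_norm_splitting_le n
  refine ⟨‖Cl.rePart n‖ * ((√(2 * Real.pi))⁻¹ *
    (2 * B + K ^ 2 * ∫ x : ℝ, ‖f (ofReal x)‖ ^ 2)), fun I hI u v => ?_⟩
  have hI1 : ‖I‖ = 1 := by simpa using hI
  have h2 := memLp_sliceFun hL2 I
  have h3 := norm_le_of_fourier_eq_zero (hf.differentiable_sliceFun hI) hB h2
    (splitting_fourierL2_ae hI hL2 h2 (sliceFun_ofReal I f))
    (ae_splitting_fourierL2_eq_zero (h0 I hI)) ⟨u, v⟩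
  -- Bounding by ∫‖f‖² over the real axis, common to all slices, removes the dependence on `I`.
  have h4 : ∫ x : ℝ, ‖sliceFun I f x‖ ^ 2 ≤ K ^ 2 * ∫ x : ℝ, ‖f (ofReal x)‖ ^ 2 := by
    rw [← integral_const_mul]
    refine integral_mono (h2.integrable_norm_pow (by norm_num))
      ((hL2.integrable_norm_pow (by norm_num)).const_mul _) fun x => ?_
    simp only [sliceFun_ofReal]
    rw [← mul_pow]
    gcongr
    exact hK I hI1 _
  rw [norm_mk u hI1 v]
  calc ‖f (Paravector.mk u I v)‖ = ‖Cl.rePart n (sliceFun I f ⟨u, v⟩)‖ := by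
        rw [sliceFun, Cl.rePart_splitting]; rfl
    _ ≤ ‖Cl.rePart n‖ * ‖sliceFun I f ⟨u, v⟩‖ := (Cl.rePart n).le_opNorm _
    _ ≤ ‖Cl.rePart n‖ * ((√(2 * Real.pi))⁻¹ * (2 * B + K ^ 2 * ∫ x : ℝ, ‖f (ofReal x)‖ ^ 2) *
        Real.exp (B * ‖(⟨u, v⟩ : ℂ)‖)) := by
        gcongr
        exact h3.trans (by gcongr)
    _ = _ := by ring

end SlicePaleyWiener

theorem mainTheorem3 (n : ℕ) (f : Paravector n → Cl n)
    (hf : IsLeftSliceMonogenicOn f Set.univ)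
    (hL2 : MemLp (fun u : ℝ => f (Paravector.ofReal u)) 2 volume)
    (B : ℝ) (hB : 0 < B) :
    ((∃ C : ℝ, ∀ I ∈ Paravector.S n, ∀ u v : ℝ,
        ‖f (Paravector.mk u I v)‖ ≤ C * Real.exp (B * ‖Paravector.mk u I v‖)) ↔
      (∀ I ∈ Paravector.S n,
        essSupport (fourierL2 I fun u : ℝ => f (Paravector.ofReal u)) ⊆ Set.Icc (-B) B)) ∧
    (((∃ C : ℝ, ∀ I ∈ Paravector.S n, ∀ u v : ℝ,
        ‖f (Paravector.mk u I v)‖ ≤ C * Real.exp (B * ‖Paravector.mk u I v‖)) ∨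
      (∀ I ∈ Paravector.S n,
        essSupport (fourierL2 I fun u : ℝ => f (Paravector.ofReal u)) ⊆ Set.Icc (-B) B)) →
      ∀ I ∈ Paravector.S n, ∀ u v : ℝ,
        f (Paravector.mk u I v) = (√(2 * Real.pi))⁻¹ • ∫ w in (-B)..B,
          NormedSpace.exp (w • (Cl.vec I * (Paravector.mk u I v).toCl)) *
            fourierL2 I (fun u : ℝ => f (Paravector.ofReal u)) w) := by
  simp only [essSupport_subset_Icc_iff]
  have h1 : (∃ C : ℝ, ∀ I ∈ Paravector.S n, ∀ u v : ℝ,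
        ‖f (Paravector.mk u I v)‖ ≤ C * Real.exp (B * ‖Paravector.mk u I v‖)) →
      ∀ I ∈ Paravector.S n, ∀ᵐ w : ℝ, B < |w| →
        fourierL2 I (fun u : ℝ => f (Paravector.ofReal u)) w = 0 := fun ⟨_, hC⟩ I hI =>
    fourierL2_eq_zero_of_exp_type hf hL2 hB.le hI (hC I hI)
  exact ⟨⟨h1, exists_norm_le_of_fourierL2_eq_zero hf hL2 hB⟩, fun h I hI u v =>
    eq_integral_fourierL2 hf hL2 hB.le hI (h.elim h1 id I hI) u v⟩
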